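/- Let $\mathbb U=\{z=x+iy:\ y>0\}$. For a locally integrable function $u$ on $\mathbb R$ put $$\|u\|_{H^{1/2}}=\Big(\frac1{4\pi^2}\int_{\mathbb R}\int_{\mathbb R}\frac{|u(x)-u(t)|^2}{|x-t|^2}\,dt\,dx\Big)^{1/2},$$ and let $H^{1/2}$ be the set of locally integrable complex-valued $u$ with $\|u\|_{H^{1/2}}<\infty$. For measurable $\mu$ on $\mathbb U$ put $$\|\mu\|_{WP}=\|\mu\|_\infty+\Big(\frac1\pi\iint_{\mathbb U}\frac{|\mu(z)|^2}{y^2}\,dx\,dy\Big)^{1/2},$$ and let $\mathcal M(\mathbb U)$ be the set of measurable $\mu$ with $\|\mu\|_\infty<1$ and $\|\mu\|_{WP}<\infty$. Let $WP(\mathbb R)$ be the class of increasing homeomorphisms of $\mathbb R$ onto itself that extend continuously to a quasiconformal mapping of $\mathbb U$ onto itself with Beltrami coefficient in $\mathcal M(\mathbb U)$. Fix $C^\infty$ real-valued functions $\varphi,\psi$ on $\mathbb R$ supported on $[-1,1]$, with $\varphi$ even, $\psi$ odd, $\int\varphi(x)\,dx=1$ and $\int\psi(x)\,x\,dx=1$.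 Write $\varphi_y(x)=y^{-1}\varphi(y^{-1}x)$, $\psi_y(x)=y^{-1}\psi(y^{-1}x)$, and $$\gamma_u(x)=\frac{\int_0^xe^{u(t)}dt}{\int_0^1e^{u(t)}dt},\qquad \rho_u(x+iy)=\varphi_y*\gamma_u(x)-i\,\psi_y*\gamma_u(x)\quad(y>0).$$ There are constants $\delta>0$ and $C$, depending only on $\varphi$ and $\psi$, with the following properties. (1) For every $u\in H^{1/2}$ with $\|u\|_{H^{1/2}}<\delta$, the function $e^u$ is locally integrable and $\int_0^1e^{u}\neq0$ (so that $\rho_u$ is well defined), $\rho_u$ is a quasiconformal mapping of $\mathbb U$ onto its image, and its Beltrami coefficient $\mu=\bar\partial\rho_u/\partial\rho_u$ satisfies $\|\mu\|_{WP}\le C\|u\|_{H^{1/2}}$ and belongs to $\mathcal M(\mathbb U)$. (2) Let $h$ be an increasing, locally absolutely continuous homeomorphism of $\mathbb R$ onto itself such that $h'>0$ almost everywhere, $\log h'\in H^{1/2}$ and $\|\log h'\|_{H^{1/2}}<\delta$. Then $h$ extends continuously to a quasiconformal mapping of $\mathbb U$ onto itself that is quasi-isometric (bi-Lipschitz) under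 the Poincaré metric $|dz|/y$ and has Beltrami coefficient in $\mathcal M(\mathbb U)$. In particular $h\in WP(\mathbb R)$. -/

import Mathlib

open MeasureTheory Set Filter Topology

noncomputable section

namespace WeilPetersson

/-- The open upper half plane, as a subset of `ℂ`. -/
abbrev U : Set ℂ := UpperHalfPlane.upperHalfPlaneSet

/-! ### The Sobolev class of order one half on the real line -/

/-- The seminorm
`‖u‖ = ( (1 / 4π²) ∫∫ |u(x) - u(t)|² / |x - t|² dt dx )^(1/2)`, with values in `[0, ∞]`. -/
def halfNorm {E : Type*} [NormedAddCommGroup E] (u : ℝ → E) : ENNReal :=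
  (ENNReal.ofReal (1 / (4 * Real.pi ^ 2)) *
    ∫⁻ x : ℝ, ∫⁻ t : ℝ, ENNReal.ofReal (‖u x - u t‖ ^ 2 / |x - t| ^ 2)) ^ (1 / 2 : ℝ)

/-- `u` belongs to `H^{1/2}`: it is locally integrable and has finite seminorm. -/
def MemHalf {E : Type*} [NormedAddCommGroup E] (u : ℝ → E) : Prop :=
  LocallyIntegrable u volume ∧ halfNorm u < ⊤

/-! ### Quasiconformal mappings (analytic definition) -/

/-- `∂f = (∂f/∂x - i ∂f/∂y) / 2`, computed from the classical partial derivatives. -/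
def dz (f : ℂ → ℂ) (z : ℂ) : ℂ :=
  (lineDeriv ℝ f z 1 - Complex.I * lineDeriv ℝ f z Complex.I) / 2

/-- `∂̄f = (∂f/∂x + i ∂f/∂y) / 2`, computed from the classical partial derivatives. -/
def dzbar (f : ℂ → ℂ) (z : ℂ) : ℂ :=
  (lineDeriv ℝ f z 1 + Complex.I * lineDeriv ℝ f z Complex.I) / 2

/-- The Beltrami coefficient `∂̄f / ∂f`. -/
def beltrami (f : ℂ → ℂ) (z : ℂ) : ℂ := dzbar f z / dz f z

/-- `f` is absolutely continuous on lines in `Ω`: in every closed rectangle contained in `Ω` it is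
absolutely continuous on almost every horizontal and almost every vertical segment. In particular
both partial derivatives of `f` then exist almost everywhere in `Ω`. -/
def IsACL (f : ℂ → ℂ) (Ω : Set ℂ) : Prop :=
  ∀ a b c d : ℝ, a < b → c < d → Icc a b ×ℂ Icc c d ⊆ Ω →
    (∀ᵐ y : ℝ, y ∈ Icc c d →
      AbsolutelyContinuousOnInterval (fun x : ℝ => f ⟨x, y⟩) a b) ∧
    (∀ᵐ x : ℝ, x ∈ Icc a b →
      AbsolutelyContinuousOnInterval (fun y : ℝ => f ⟨x, y⟩) c d)

/-- `f` is a quasiconformal mapping of the open set `Ω` (onto the open set `f '' Ω`): a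
homeomorphism of `Ω` onto its image that is absolutely continuous on lines and satisfies
`|∂̄f| ≤ k |∂f|` almost everywhere in `Ω` for some constant `k < 1`. -/
structure IsQuasiconformalOn (f : ℂ → ℂ) (Ω : Set ℂ) : Prop where
  homeo : IsOpenEmbedding (Ω.domRestrict f)
  acl : IsACL f Ω
  dilatation : ∃ k : ℝ, 0 ≤ k ∧ k < 1 ∧
    ∀ᵐ z ∂(volume.restrict Ω), ‖dzbar f z‖ ≤ k * ‖dz f z‖

/-- `w`, a map of the upper half plane into itself, is quasi-isometric under the Poincaré metric
`|dz| / y`, that is, bi-Lipschitz for the hyperbolic distance (which is the distance that Mathlib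
puts on `UpperHalfPlane`). -/
def IsQuasiIsometric (w : ℂ → ℂ) : Prop :=
  ∃ F : UpperHalfPlane → UpperHalfPlane, (∀ z : UpperHalfPlane, (F z : ℂ) = w z) ∧
    ∃ L : NNReal, LipschitzWith L F ∧ AntilipschitzWith L F

/-! ### Weil-Petersson Beltrami coefficients and the Weil-Petersson class -/

/-- The Weil-Petersson norm
`‖μ‖_∞ + ( (1/π) ∫∫_U |μ(z)|² / y² dx dy )^(1/2)`, with values in `[0, ∞]`. -/
def wpNorm (μ : ℂ → ℂ) : ENNReal :=
  eLpNorm μ ⊤ (volume.restrict U) +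
    (ENNReal.ofReal (1 / Real.pi) *
      ∫⁻ z in U, ENNReal.ofReal (‖μ z‖ ^ 2 / z.im ^ 2)) ^ (1 / 2 : ℝ)

/-- The open unit ball `M(U)` of `L^∞(U)`. -/
def ballM : Set (ℂ → ℂ) :=
  {μ | AEStronglyMeasurable μ (volume.restrict U) ∧ eLpNorm μ ⊤ (volume.restrict U) < 1}

/-- The space of measurable functions on `U` with finite Weil-Petersson norm. -/
def spaceL : Set (ℂ → ℂ) :=
  {μ | AEStronglyMeasurable μ (volume.restrict U) ∧ wpNorm μ < ⊤}

/-- The class of Weil-Petersson Beltrami coefficients, the intersection of the two. -/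
def classM : Set (ℂ → ℂ) := ballM ∩ spaceL

/-- `h` is an increasing homeomorphism of the real line onto itself. -/
def IsIncreasingHomeo (h : ℝ → ℝ) : Prop :=
  StrictMono h ∧ Continuous h ∧ Function.Surjective h

/-- `w` is a quasiconformal mapping of the upper half plane onto itself with boundary values `h`
on the real line. -/
def IsQCExtension (w : ℂ → ℂ) (h : ℝ → ℝ) : Prop :=
  IsQuasiconformalOn w U ∧ w '' U = U ∧
    ∀ x : ℝ, Tendsto w (𝓝[U] (x : ℂ)) (𝓝 (h x : ℂ))

/-- The Weil-Petersson class on the real line. -/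
def classWP : Set (ℝ → ℝ) :=
  {h | IsIncreasingHomeo h ∧ ∃ w : ℂ → ℂ, IsQCExtension w h ∧ beltrami w ∈ classM}

/-! ### Semmes' construction -/

/-- `γ_u(x) = ∫₀ˣ e^u / ∫₀¹ e^u`. -/
def gammaMap (u : ℝ → ℂ) (x : ℝ) : ℂ :=
  (∫ t in (0 : ℝ)..x, Complex.exp (u t)) / ∫ t in (0 : ℝ)..1, Complex.exp (u t)

/-- The convolution `φ_y * v (x)`, where `φ_y(x) = φ(x / y) / y`. -/
def convScale (φ : ℝ → ℝ) (y : ℝ) (v : ℝ → ℂ) (x : ℝ) : ℂ :=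
  ∫ t : ℝ, ((y⁻¹ * φ (y⁻¹ * (x - t)) : ℝ) : ℂ) * v t

/-- Semmes' map `ρ_u(x + iy) = φ_y * γ_u (x) - i ψ_y * γ_u (x)` (used for `y > 0` only). -/
def rhoMap (φ ψ : ℝ → ℝ) (u : ℝ → ℂ) (z : ℂ) : ℂ :=
  convScale φ z.im (gammaMap u) z.re - Complex.I * convScale ψ z.im (gammaMap u) z.re

/-- The kernels of Semmes' construction: smooth real functions supported on `[-1, 1]`, the first
even with `∫ φ = 1`, the second odd with `∫ x ψ(x) dx = 1`. -/
structure IsSemmesPair (φ ψ : ℝ → ℝ) : Prop where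
  smooth_even : ContDiff ℝ (⊤ : ℕ∞) φ
  smooth_odd : ContDiff ℝ (⊤ : ℕ∞) ψ
  support_even : Function.support φ ⊆ Icc (-1) 1
  support_odd : Function.support ψ ⊆ Icc (-1) 1
  even : Function.Even φ
  odd : Function.Odd ψ
  integral_even : ∫ x : ℝ, φ x = 1
  integral_odd : ∫ x : ℝ, ψ x * x = 1

end WeilPetersson

end

noncomputable section

namespace WeilPetersson

open Metric

/-! ### The energy of a function and its localizations -/

/-! Put e = 2π‖u‖, so that `energy u` is e². The energy controls the difference of the means of u
over intervals of comparable length. Chaining such differences along shrinking dyadic intervals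
gives an inequality of John-Nirenberg type, `lintegral_exp_norm_sub_mean_le`. With Cauchy-Schwarz it
follows that the average of |e^(u-a) - 1| over an interval, a being the mean of u there, is O(e),
and that its square is at most a constant times the local energy divided by the squared length
(`expOsc_sq_le`).

The kernel K = φ - iψ has ∫ K = 1 and ∫ sK(s) ds = -i, so x + iy ↦ ∫ K(s) γ(x - ys) ds extends
affine maps of the line to affine maps of the plane. If γ is a primitive of c e^u and κ = c e^a,
then γ minus the linear function of slope κ is a primitive of κ(e^(u-a) - 1). Hence the extension is
multiplication by κ up to a small error (`IsKernel.enorm_kernelExt_sub_le`). An interval adapted to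
one point yields local invertibility and bounds the Beltrami coefficient by the oscillation at that
point; an interval adapted to two points yields injectivity. In the integral of |μ|²/y² the local
energies recombine, by Tonelli, to the full energy (`lintegral_U_localEnergy_le`).

For real h take γ = h and u = log h'. The slopes κ are now positive, so the extension preserves the
half plane; heights and mutual distances are multiplied by such slopes up to factors close to 1.
Slopes at different scales differ at most by a small power of the ratio of the scales, and the
formula for sinh of half the hyperbolic distance turns this into a bi-Lipschitz bound
(`dist_le_of_comparable`). The image is then open and closed in the half plane, hence all of it. -/

/-- The double integral `∫∫ |u(x) - u(t)|² / |x - t|² dt dx`. -/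
def energy (u : ℝ → ℂ) : ENNReal :=
  ∫⁻ x : ℝ, ∫⁻ t : ℝ, ENNReal.ofReal (‖u x - u t‖ ^ 2 / |x - t| ^ 2)

/-- The double integral of `|u(s) - u(t)|²` over the square of an interval. -/
def localEnergy (u : ℝ → ℂ) (x r : ℝ) : ENNReal :=
  ∫⁻ s in closedBall x r, ∫⁻ t in closedBall x r, ‖u s - u t‖ₑ ^ 2

/-- The mean of `u` over the interval of centre `x` and radius `r`. -/
def mean (u : ℝ → ℂ) (x r : ℝ) : ℂ := ⨍ t in closedBall x r, u t

lemma enorm_sub_sq_le (u : ℝ → ℂ) {s t R : ℝ} (h : |s - t| ≤ R) :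
    ‖u s - u t‖ₑ ^ 2 ≤
      ENNReal.ofReal (R ^ 2) * ENNReal.ofReal (‖u s - u t‖ ^ 2 / |s - t| ^ 2) := by
  rw [← ENNReal.ofReal_mul (by positivity), ← ofReal_norm,
    ← ENNReal.ofReal_pow (norm_nonneg _)]
  apply ENNReal.ofReal_le_ofReal
  rcases eq_or_ne s t with rfl | hst
  · simp
  · have h0 : 0 < |s - t| := abs_pos.2 (sub_ne_zero.2 hst)
    rw [← mul_div_assoc, le_div_iff₀ (by positivity), mul_comm]
    gcongr

lemma lintegral_indicator_le_energy (u : ℝ → ℂ) (R : ℝ) :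
    ∫⁻ s : ℝ, ∫⁻ t : ℝ, {t | |s - t| ≤ R}.indicator (fun t => ‖u s - u t‖ₑ ^ 2) t ≤
      ENNReal.ofReal (R ^ 2) * energy u := by
  unfold energy
  rw [← lintegral_const_mul' _ _ ENNReal.ofReal_ne_top]
  refine lintegral_mono fun s => ?_
  rw [← lintegral_const_mul' _ _ ENNReal.ofReal_ne_top]
  refine lintegral_mono fun t => ?_
  by_cases h : |s - t| ≤ R
  · exact (indicator_le_self _ _ _).trans (enorm_sub_sq_le u h)
  · rw [indicator_of_notMem (by exact h)]
    exact zero_le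

lemma localEnergy_le (u : ℝ → ℂ) (x r : ℝ) :
    localEnergy u x r ≤ ENNReal.ofReal ((2 * r) ^ 2) * energy u := by
  unfold localEnergy energy
  rw [← lintegral_const_mul' _ _ ENNReal.ofReal_ne_top]
  refine (setLIntegral_mono' measurableSet_closedBall fun s hs => ?_).trans
    (setLIntegral_le_lintegral _ _)
  rw [← lintegral_const_mul' _ _ ENNReal.ofReal_ne_top]
  refine (setLIntegral_mono' measurableSet_closedBall fun t ht => ?_).trans
    (setLIntegral_le_lintegral _ _)
  apply enorm_sub_sq_le
  rw [mem_closedBall, Real.dist_eq, abs_le] at hs ht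
  rw [abs_le]; constructor <;> linarith [hs.1, hs.2, ht.1, ht.2]

lemma sq_lintegral_mul_le {α : Type*} [MeasurableSpace α] {μ : Measure α} {f g : α → ENNReal}
    (hf : AEMeasurable f μ) (hg : AEMeasurable g μ) :
    (∫⁻ a, f a * g a ∂μ) ^ 2 ≤ (∫⁻ a, f a ^ 2 ∂μ) * ∫⁻ a, g a ^ 2 ∂μ := by
  have h := ENNReal.lintegral_mul_le_Lp_mul_Lq μ Real.HolderConjugate.two_two hf hg
  simp only [Pi.mul_apply, ENNReal.rpow_two] at h
  calc _ ≤ ((∫⁻ a, f a ^ 2 ∂μ) ^ (1 / 2 : ℝ) * (∫⁻ a, g a ^ 2 ∂μ) ^ (1 / 2 : ℝ)) ^ 2 := by gcongr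
    _ = _ := by
      rw [mul_pow]
      simp only [← ENNReal.rpow_natCast, ← ENNReal.rpow_mul]
      norm_num

lemma sq_lintegral_le {α : Type*} [MeasurableSpace α] {μ : Measure α} {f : α → ENNReal}
    (hf : AEMeasurable f μ) : (∫⁻ a, f a ∂μ) ^ 2 ≤ μ univ * ∫⁻ a, f a ^ 2 ∂μ := by
  simpa using sq_lintegral_mul_le (μ := μ) (f := fun _ => 1) (g := f) aemeasurable_const hf

/-- Cauchy-Schwarz for the average; 2r is the length of the interval. -/
lemma enorm_mean_sub_sq_le {u : ℝ → ℂ} (hu : LocallyIntegrable u volume) (c : ℂ) {x r : ℝ}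
    (hr : 0 < r) :
    ‖mean u x r - c‖ₑ ^ 2 * ENNReal.ofReal (2 * r) ≤ ∫⁻ t in closedBall x r, ‖u t - c‖ₑ ^ 2 := by
  have hi : IntegrableOn u (closedBall x r) := hu.integrableOn_isCompact (isCompact_closedBall x r)
  have hc : IntegrableOn (fun _ => c) (closedBall x r) :=
    integrableOn_const measure_closedBall_lt_top.ne
  have hV : volume.real (closedBall x r) = 2 * r := by
    simp [Measure.real, hr.le]
  have h1 : (2 * r) • (mean u x r - c) = ∫ t in closedBall x r, (u t - c) := by
    rw [integral_sub hi hc, mean, setAverage_eq, hV, smul_sub, smul_smul,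
      mul_inv_cancel₀ (by positivity), one_smul]
    simp [hV]
  have h2 : ENNReal.ofReal (2 * r) * ‖mean u x r - c‖ₑ ≤ ∫⁻ t in closedBall x r, ‖u t - c‖ₑ := by
    rw [← Real.enorm_of_nonneg (by positivity : 0 ≤ 2 * r), ← enorm_smul, h1]
    exact enorm_integral_le_lintegral_enorm _
  have h3 : (∫⁻ t in closedBall x r, ‖u t - c‖ₑ) ^ 2 ≤
      ENNReal.ofReal (2 * r) * ∫⁻ t in closedBall x r, ‖u t - c‖ₑ ^ 2 := by
    have := sq_lintegral_le (μ := volume.restrict (closedBall x r)) (f := fun t => ‖u t - c‖ₑ)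
      (hi.sub hc).aestronglyMeasurable.enorm
    simpa using this
  have h4 : ENNReal.ofReal (2 * r) * (‖mean u x r - c‖ₑ ^ 2 * ENNReal.ofReal (2 * r)) ≤
      ENNReal.ofReal (2 * r) * ∫⁻ t in closedBall x r, ‖u t - c‖ₑ ^ 2 := by
    refine le_trans (le_of_eq ?_) ((pow_le_pow_left' h2 2).trans h3)
    ring
  exact (ENNReal.mul_le_mul_iff_right (by simpa using hr) ENNReal.ofReal_ne_top).1 h4

lemma lintegral_sub_mean_sq_le {u : ℝ → ℂ} (hu : LocallyIntegrable u volume) {x r x' r' p R : ℝ}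
    (hr' : 0 < r') (h : closedBall x r ⊆ closedBall p R) (h' : closedBall x' r' ⊆ closedBall p R) :
    (∫⁻ t in closedBall x r, ‖u t - mean u x' r'‖ₑ ^ 2) * ENNReal.ofReal (2 * r') ≤
      localEnergy u p R := by
  rw [← lintegral_mul_const' _ _ ENNReal.ofReal_ne_top]
  refine (lintegral_mono fun s => ?_).trans (lintegral_mono_set h)
  rw [enorm_sub_rev]
  refine (enorm_mean_sub_sq_le hu (u s) hr').trans ((lintegral_mono_set h').trans ?_)
  simp only [enorm_sub_rev, le_refl]

lemma enorm_mean_sub_mean_sq_le {u : ℝ → ℂ} (hu : LocallyIntegrable u volume)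
    {x r x' r' p R : ℝ} (hr : 0 < r) (hr' : 0 < r') (h : closedBall x r ⊆ closedBall p R)
    (h' : closedBall x' r' ⊆ closedBall p R) :
    ‖mean u x r - mean u x' r'‖ₑ ^ 2 * (ENNReal.ofReal (2 * r) * ENNReal.ofReal (2 * r')) ≤
      localEnergy u p R := by
  rw [← mul_assoc]
  exact (mul_le_mul_left (enorm_mean_sub_sq_le hu _ hr) _).trans
    (lintegral_sub_mean_sq_le hu hr' h h')

/-- All later comparisons of means rest on this: the constant k only measures how much longer the
common interval is than the geometric mean of the two lengths. -/
lemma norm_mean_sub_mean_le {u : ℝ → ℂ} (hu : LocallyIntegrable u volume) {e k : ℝ}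
    (he : 0 ≤ e) (hk : 0 ≤ k) (hE : energy u ≤ ENNReal.ofReal (e ^ 2))
    {x r x' r' p R : ℝ} (hr : 0 < r) (hr' : 0 < r') (h : closedBall x r ⊆ closedBall p R)
    (h' : closedBall x' r' ⊆ closedBall p R) (hR : R ^ 2 ≤ k ^ 2 * (r * r')) :
    ‖mean u x r - mean u x' r'‖ ≤ k * e := by
  have h1 := (enorm_mean_sub_mean_sq_le hu hr hr' h h').trans
    ((localEnergy_le u p R).trans (mul_le_mul_right hE _))
  rw [← ofReal_norm, ← ENNReal.ofReal_pow (norm_nonneg _),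
    ← ENNReal.ofReal_mul (by positivity), ← ENNReal.ofReal_mul (by positivity),
    ← ENNReal.ofReal_mul (by positivity), ENNReal.ofReal_le_ofReal_iff (by positivity)] at h1
  have h2 : ‖mean u x r - mean u x' r'‖ ^ 2 * (r * r') ≤ (k * e) ^ 2 * (r * r') := by
    nlinarith [sq_nonneg e, mul_le_mul_of_nonneg_right hR (sq_nonneg e)]
  have h3 := le_of_mul_le_mul_right h2 (mul_pos hr hr')
  exact le_of_sq_le_sq h3 (by positivity)

/-- The points `((x, r), s, t)` for which `s` and `t` lie in the interval of centre `x` and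
radius `r`. -/
def window : Set ((ℝ × ℝ) × ℝ × ℝ) := {p | |p.2.1 - p.1.1| ≤ p.1.2 ∧ |p.2.2 - p.1.1| ≤ p.1.2}

lemma measurableSet_window : MeasurableSet window :=
  ((isClosed_le (f := fun p : (ℝ × ℝ) × ℝ × ℝ => |p.2.1 - p.1.1|) (g := fun p => p.1.2)
    (by fun_prop) (by fun_prop)).inter
    (isClosed_le (f := fun p : (ℝ × ℝ) × ℝ × ℝ => |p.2.2 - p.1.1|) (g := fun p => p.1.2)
    (by fun_prop) (by fun_prop))).measurableSet

lemma measurable_window_indicator {u : ℝ → ℂ} (hu : Measurable u) :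
    Measurable (window.indicator fun p => ‖u p.2.1 - u p.2.2‖ₑ ^ 2) :=
  Measurable.indicator (by fun_prop) measurableSet_window

/-- A single jointly measurable integrand in centre, radius, s and t, as needed for measurability in
the parameters and for Tonelli. -/
lemma localEnergy_eq (u : ℝ → ℂ) (x r : ℝ) : localEnergy u x r =
    ∫⁻ s, ∫⁻ t, window.indicator (fun p => ‖u p.2.1 - u p.2.2‖ₑ ^ 2) ((x, r), s, t) := by
  unfold localEnergy
  rw [← lintegral_indicator measurableSet_closedBall]
  refine lintegral_congr fun s => ?_
  by_cases hs : s ∈ closedBall x r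
  · rw [indicator_of_mem hs, ← lintegral_indicator measurableSet_closedBall]
    refine lintegral_congr fun t => ?_
    rw [mem_closedBall, Real.dist_eq] at hs
    by_cases ht : t ∈ closedBall x r
    · rw [indicator_of_mem ht]
      rw [mem_closedBall, Real.dist_eq] at ht
      have : ((x, r), s, t) ∈ window := ⟨hs, ht⟩
      simp only [indicator_of_mem this]
    · rw [indicator_of_notMem ht]
      rw [mem_closedBall, Real.dist_eq] at ht
      have : ((x, r), s, t) ∉ window := fun h => ht h.2
      simp only [indicator_of_notMem this]
  · rw [indicator_of_notMem hs]
    rw [mem_closedBall, Real.dist_eq] at hs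
    have : ∀ t, ((x, r), s, t) ∉ window := fun t h => hs h.1
    simp only [indicator_of_notMem (this _), lintegral_zero]

lemma measurable_localEnergy {u : ℝ → ℂ} (hu : Measurable u) :
    Measurable fun p : ℝ × ℝ => localEnergy u p.1 p.2 := by
  simp only [localEnergy_eq]
  have h := measurable_window_indicator hu
  refine Measurable.lintegral_prod_right' (f := fun q : (ℝ × ℝ) × ℝ => ∫⁻ t,
    window.indicator (fun p => ‖u p.2.1 - u p.2.2‖ₑ ^ 2) (q.1, q.2, t)) ?_
  exact Measurable.lintegral_prod_right' (f := fun q : ((ℝ × ℝ) × ℝ) × ℝ =>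
    window.indicator (fun p => ‖u p.2.1 - u p.2.2‖ₑ ^ 2) (q.1.1, q.1.2, q.2))
    (h.comp (by fun_prop))

/-- By Tonelli: for fixed s and t, the centres x whose interval contains both points lie in an
interval of length 2r about s, and there are none unless |s - t| ≤ 2r. -/
lemma lintegral_localEnergy_le {u : ℝ → ℂ} (hu : Measurable u) (r : ℝ) :
    ∫⁻ x : ℝ, localEnergy u x r ≤ ENNReal.ofReal (2 * r) *
      ∫⁻ s : ℝ, ∫⁻ t : ℝ, {t | |s - t| ≤ 2 * r}.indicator (fun t => ‖u s - u t‖ₑ ^ 2) t := by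
  let F : ℝ × ℝ × ℝ → ENNReal := fun q =>
    window.indicator (fun p => ‖u p.2.1 - u p.2.2‖ₑ ^ 2) ((q.1, r), q.2.1, q.2.2)
  have hF : Measurable F := (measurable_window_indicator hu).comp (by fun_prop)
  have h1 : ∀ x, localEnergy u x r = ∫⁻ s, ∫⁻ t, F (x, s, t) := fun x => localEnergy_eq u x r
  simp only [h1]
  rw [lintegral_lintegral_swap (Measurable.aemeasurable (by fun_prop)),
    ← lintegral_const_mul' _ _ ENNReal.ofReal_ne_top]
  refine lintegral_mono fun s => ?_
  rw [lintegral_lintegral_swap (Measurable.aemeasurable (by fun_prop)),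
    ← lintegral_const_mul' _ _ ENNReal.ofReal_ne_top]
  refine lintegral_mono fun t => ?_
  have h2 : ∀ x, F (x, s, t) ≤ (closedBall s r).indicator
      (fun _ => {t | |s - t| ≤ 2 * r}.indicator (fun t => ‖u s - u t‖ₑ ^ 2) t) x := by
    intro x
    by_cases hx : ((x, r), s, t) ∈ window
    · have h3 : x ∈ closedBall s r := by
        rw [mem_closedBall', Real.dist_eq]; exact hx.1
      have h4 : t ∈ {t | |s - t| ≤ 2 * r} := by
        have h5 := abs_le.1 hx.1
        have h6 := abs_le.1 hx.2
        simp only at h5 h6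
        rw [mem_ofPred_eq, abs_le]; constructor <;> linarith [h5.1, h5.2, h6.1, h6.2]
      simp only [F, indicator_of_mem hx, indicator_of_mem h3, indicator_of_mem h4, le_refl]
    · simp only [F, indicator_of_notMem hx, zero_le]
  refine (lintegral_mono h2).trans ?_
  rw [lintegral_indicator_const measurableSet_closedBall, Real.volume_closedBall, mul_comm]

/-! ### Exponential integrability -/

lemma exp_sub_exp_le (a b : ℝ) : Real.exp (a + b) ≤ Real.exp a + b * Real.exp (a + b) := by
  have h := Real.add_one_le_exp (-b)
  have h2 : Real.exp a = Real.exp (a + b) * Real.exp (-b) := by rw [← Real.exp_add]; ring_nf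
  have := Real.exp_pos (a + b)
  rw [h2]; nlinarith

/-- Telescoping of exp(2s). Each increment of the exponential is at most 2A times its final value,
and that value grows at most geometrically because s grows at most linearly. -/
lemma exp_le_sum_of_increments {e : ℝ} (s A : ℕ → ℝ) (h0 : s 0 ≤ 2 * e)
    (hA0 : ∀ n, 0 ≤ A n) (hA : ∀ n, A n ≤ 2 * e) (hs : ∀ n, s (n + 1) ≤ s n + A n) (N : ℕ) :
    s N ≤ 2 * e * (N + 1) ∧ Real.exp (2 * s N) ≤ Real.exp (4 * e) +
      ∑ n ∈ Finset.range N, 2 * A n * Real.exp (4 * e) ^ (n + 2) := by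
  induction N with
  | zero => simpa using ⟨h0, by linarith⟩
  | succ N ih =>
    have h1 : s (N + 1) ≤ 2 * e * (N + 1) + 2 * e := by linarith [hs N, hA N]
    refine ⟨by push_cast; linarith, ?_⟩
    rw [Finset.sum_range_succ, ← add_assoc]
    have h2 : Real.exp (2 * s (N + 1)) ≤ Real.exp (2 * s N + 2 * A N) :=
      Real.exp_le_exp.2 (by linarith [hs N])
    have h3 : Real.exp (2 * s N + 2 * A N) ≤ Real.exp (4 * e) ^ (N + 2) := by
      rw [← Real.exp_nat_mul]
      apply Real.exp_le_exp.2
      push_cast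
      linarith [ih.1, hA N]
    have h4 := exp_sub_exp_le (2 * s N) (2 * A N)
    have h5 := mul_le_mul_of_nonneg_left h3 (by linarith [hA0 N] : 0 ≤ 2 * A N)
    linarith [ih.2]

/-- The growth rate is exp(4e) ≤ 6/5. Splitting 2A ≤ (3/4)^n + (4/3)^n A² makes the first part
summable, with ratio 9/10, and leaves A² with weight (8/5)^n. What matters is 8/5 < 2, since
integration over the centre later gains a factor 2^(-n). -/
lemma exp_le_sum_sq_of_increments {e : ℝ} (he' : e ≤ 1 / 40) (s A : ℕ → ℝ)
    (h0 : s 0 ≤ 2 * e) (hA0 : ∀ n, 0 ≤ A n) (hA : ∀ n, A n ≤ 2 * e)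
    (hs : ∀ n, s (n + 1) ≤ s n + A n) (N : ℕ) :
    Real.exp (2 * s N) ≤ 16 + ∑ n ∈ Finset.range N, 2 * ((8 / 5) ^ n * A n ^ 2) := by
  have hexp : Real.exp (4 * e) ≤ 6 / 5 := by
    have h1 : Real.exp (4 * e) ≤ Real.exp (1 / 10) := Real.exp_le_exp.2 (by linarith)
    have h2 := Real.exp_bound_div_one_sub_of_interval (x := 1 / 10) (by norm_num) (by norm_num)
    exact h1.trans (h2.trans (by norm_num))
  have hpos := Real.exp_pos (4 * e)
  have h := (exp_le_sum_of_increments s A h0 hA0 hA hs N).2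
  have hterm : ∀ n, 2 * A n * Real.exp (4 * e) ^ (n + 2) ≤
      36 / 25 * (9 / 10) ^ n + 2 * ((8 / 5) ^ n * A n ^ 2) := by
    intro n
    have h1 : Real.exp (4 * e) ^ (n + 2) ≤ (6 / 5) ^ (n + 2) := by gcongr
    have h2 : 2 * A n ≤ (3 / 4) ^ n + (4 / 3) ^ n * A n ^ 2 := by
      have h3 : (3 / 4 : ℝ) ^ n * (4 / 3) ^ n = 1 := by rw [← mul_pow]; norm_num
      have h4 : (0 : ℝ) < (3 / 4) ^ n := by positivity
      have h5 : (3 / 4 : ℝ) ^ n * (2 * A n) ≤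
          (3 / 4) ^ n * ((3 / 4) ^ n + (4 / 3) ^ n * A n ^ 2) := by
        have : (3 / 4 : ℝ) ^ n * ((3 / 4) ^ n + (4 / 3) ^ n * A n ^ 2) =
          (3 / 4) ^ n * (3 / 4) ^ n + ((3 / 4) ^ n * (4 / 3) ^ n) * A n ^ 2 := by ring
        rw [this, h3]
        nlinarith [sq_nonneg ((3 / 4) ^ n - A n)]
      exact le_of_mul_le_mul_left h5 h4
    have e1 : (9 / 10 : ℝ) ^ n = (6 / 5) ^ n * (3 / 4) ^ n := by rw [← mul_pow]; norm_num
    have e2 : (8 / 5 : ℝ) ^ n = (6 / 5) ^ n * (4 / 3) ^ n := by rw [← mul_pow]; norm_num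
    calc 2 * A n * Real.exp (4 * e) ^ (n + 2)
        ≤ ((3 / 4) ^ n + (4 / 3) ^ n * A n ^ 2) * (6 / 5) ^ (n + 2) := by
          have := hA0 n
          gcongr
      _ = 36 / 25 * (9 / 10) ^ n + 36 / 25 * ((8 / 5) ^ n * A n ^ 2) := by rw [e1, e2]; ring
      _ ≤ _ := by
          have : 0 ≤ (8 / 5 : ℝ) ^ n * A n ^ 2 := by positivity
          linarith
  have hgeom : ∑ n ∈ Finset.range N, (36 / 25 : ℝ) * (9 / 10) ^ n ≤ 36 / 25 * 10 := by
    rw [← Finset.mul_sum]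
    gcongr
    rw [geom_sum_eq (by norm_num)]
    have : (0 : ℝ) ≤ (9 / 10) ^ N := by positivity
    rw [div_le_iff_of_neg (by norm_num)]
    linarith
  have hsum := Finset.sum_le_sum fun n (_ : n ∈ Finset.range N) => hterm n
  rw [Finset.sum_add_distrib] at hsum
  linarith

lemma ae_tendsto_mean {u : ℝ → ℂ} (hu : LocallyIntegrable u volume) {r : ℝ} (hr : 0 < r) :
    ∀ᵐ x : ℝ, Tendsto (fun n : ℕ => mean u x (r / 2 ^ n)) atTop (𝓝 (u x)) := by
  filter_upwards [IsUnifLocDoublingMeasure.ae_tendsto_average volume hu 0] with x hx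
  refine hx (fun _ => x) (fun n : ℕ => r / 2 ^ n) ?_ (Eventually.of_forall fun n => by simp)
  rw [tendsto_nhdsWithin_iff]
  refine ⟨?_, Eventually.of_forall fun n => by rw [mem_Ioi]; positivity⟩
  have := (tendsto_pow_atTop_nhds_zero_of_lt_one (by norm_num : (0 : ℝ) ≤ 1 / 2)
    (by norm_num)).const_mul r
  simpa [div_eq_mul_inv] using this

/-- At a Lebesgue point, u(x) is the limit of the means over intervals of radius r/2^n about x. The
increment lemma applies to these means, and the square of each increment is bounded by a local
energy. -/
lemma ae_exp_norm_sub_mean_le {u : ℝ → ℂ} (hu : LocallyIntegrable u volume)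
    {e : ℝ} (he : 0 ≤ e) (he' : e ≤ 1 / 40) (hE : energy u ≤ ENNReal.ofReal (e ^ 2))
    {x₀ r : ℝ} (hr : 0 < r) :
    ∀ᵐ x : ℝ, x ∈ closedBall x₀ r → ENNReal.ofReal (Real.exp (2 * ‖u x - mean u x₀ r‖)) ≤
      16 + ∑' n : ℕ, ENNReal.ofReal ((32 / 5) ^ n / r ^ 2) *
        localEnergy u x (r / 2 ^ n) := by
  filter_upwards [ae_tendsto_mean hu hr] with x hx hxB
  have hlim : Tendsto (fun n : ℕ => ENNReal.ofReal
      (Real.exp (2 * ‖mean u x (r / 2 ^ n) - mean u x₀ r‖))) atTop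
      (𝓝 (ENNReal.ofReal (Real.exp (2 * ‖u x - mean u x₀ r‖)))) := by
    refine (ENNReal.continuous_ofReal.tendsto _).comp ?_
    refine (Real.continuous_exp.tendsto _).comp ?_
    exact (hx.sub_const _).norm.const_mul 2
  refine le_of_tendsto' hlim fun N => ?_
  have hsub : ∀ n : ℕ, closedBall x (r / 2 ^ (n + 1)) ⊆ closedBall x (r / 2 ^ n) := fun n =>
    closedBall_subset_closedBall (by gcongr <;> norm_num)
  have hrn : ∀ n : ℕ, 0 < r / 2 ^ n := fun n => by positivity
  have h := exp_le_sum_sq_of_increments he' (fun n => ‖mean u x (r / 2 ^ n) - mean u x₀ r‖)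
    (fun n => ‖mean u x (r / 2 ^ (n + 1)) - mean u x (r / 2 ^ n)‖) ?_ (fun n => norm_nonneg _)
    (fun n => ?_) (fun n => ?_) N
  · refine (ENNReal.ofReal_le_ofReal h).trans ?_
    rw [ENNReal.ofReal_add (by norm_num) (by positivity), ENNReal.ofReal_sum_of_nonneg
      (fun n _ => by positivity)]
    gcongr
    · simp
    · refine (Finset.sum_le_sum fun n _ => ?_).trans (ENNReal.sum_le_tsum (Finset.range N))
      have h1 := enorm_mean_sub_mean_sq_le hu (hrn (n + 1)) (hrn n) (hsub n) subset_rfl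
      refine le_trans ?_ (mul_le_mul_right h1 _)
      rw [← ofReal_norm, ← ENNReal.ofReal_pow (norm_nonneg _), ← ENNReal.ofReal_mul (by positivity),
        ← ENNReal.ofReal_mul (by positivity), ← ENNReal.ofReal_mul (by positivity)]
      apply ENNReal.ofReal_le_ofReal
      apply le_of_eq
      -- The factor 4^n comes from dividing the local energy by the product of the two interval
      -- lengths.
      have h4 : (32 / 5 : ℝ) ^ n = (8 / 5) ^ n * 2 ^ n * 2 ^ n := by
        rw [← mul_pow, ← mul_pow]; norm_num
      rw [h4, pow_succ]
      field_simp
      ring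
  · simp only [pow_zero, div_one]
    refine norm_mean_sub_mean_le hu he (by norm_num) hE hr hr (p := x₀) (R := 2 * r) ?_ ?_
      (by nlinarith)
    · apply closedBall_subset_closedBall'
      rw [mem_closedBall] at hxB
      linarith
    · exact closedBall_subset_closedBall (by linarith)
  · refine norm_mean_sub_mean_le hu he (by norm_num) hE (hrn _) (hrn n) (hsub n) subset_rfl ?_
    have h2 : r / 2 ^ (n + 1) = r / 2 ^ n / 2 := by rw [pow_succ, div_div]
    rw [h2]
    nlinarith [hrn n]
  · have := norm_sub_le_norm_sub_add_norm_sub (mean u x (r / 2 ^ (n + 1)))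
      (mean u x (r / 2 ^ n)) (mean u x₀ r)
    linarith

lemma lintegral_exp_norm_sub_mean_le {u : ℝ → ℂ} (hm : Measurable u)
    (hu : LocallyIntegrable u volume) {e : ℝ} (he : 0 ≤ e) (he' : e ≤ 1 / 40)
    (hE : energy u ≤ ENNReal.ofReal (e ^ 2)) {x₀ r : ℝ} (hr : 0 < r) :
    ∫⁻ x in closedBall x₀ r, ENNReal.ofReal (Real.exp (2 * ‖u x - mean u x₀ r‖)) ≤
      ENNReal.ofReal (40 * r) := by
  have hmeas : ∀ n : ℕ, Measurable fun x => localEnergy u x (r / 2 ^ n) := fun n =>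
    (measurable_localEnergy hm).comp (measurable_id.prodMk measurable_const)
  refine (lintegral_mono_ae ((ae_restrict_iff' measurableSet_closedBall).2
    (ae_exp_norm_sub_mean_le hu he he' hE hr))).trans ?_
  rw [lintegral_add_left measurable_const, lintegral_tsum fun n =>
    ((hmeas n).const_mul _).aemeasurable]
  have h1 : ∀ n : ℕ, ∫⁻ x in closedBall x₀ r, ENNReal.ofReal ((32 / 5) ^ n / r ^ 2) *
      localEnergy u x (r / 2 ^ n) ≤ ENNReal.ofReal (8 * r * e ^ 2 * (4 / 5) ^ n) := by
    intro n
    rw [lintegral_const_mul' _ _ ENNReal.ofReal_ne_top]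
    have h2 : ∫⁻ x in closedBall x₀ r, localEnergy u x (r / 2 ^ n) ≤
        ENNReal.ofReal (2 * (r / 2 ^ n)) *
          (ENNReal.ofReal ((2 * (r / 2 ^ n)) ^ 2) * ENNReal.ofReal (e ^ 2)) :=
      (setLIntegral_le_lintegral _ _).trans ((lintegral_localEnergy_le hm _).trans
        (mul_le_mul_right ((lintegral_indicator_le_energy u _).trans
          (mul_le_mul_right hE _)) _))
    refine (mul_le_mul_right h2 _).trans ?_
    rw [← ENNReal.ofReal_mul (by positivity), ← ENNReal.ofReal_mul (by positivity),
      ← ENNReal.ofReal_mul (by positivity)]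
    apply ENNReal.ofReal_le_ofReal
    apply le_of_eq
    -- Integration over the centre gives 8^(-n): one factor 2^(-n) from the measure of centres and
    -- 4^(-n) from the squared range of |s - t|. The series therefore has ratio 4/5.
    have h4 : (32 / 5 : ℝ) ^ n = (4 / 5) ^ n * 2 ^ n * 2 ^ n * 2 ^ n := by
      rw [← mul_pow, ← mul_pow, ← mul_pow]; norm_num
    rw [h4]
    field_simp
    ring
  have hs : HasSum (fun n : ℕ => 8 * r * e ^ 2 * (4 / 5 : ℝ) ^ n) (8 * r * e ^ 2 * 5) := by
    have := (hasSum_geometric_of_lt_one (r := (4 / 5 : ℝ)) (by norm_num) (by norm_num)).mul_left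
      (8 * r * e ^ 2)
    rwa [show (1 - 4 / 5 : ℝ)⁻¹ = 5 by norm_num] at this
  have h2 := ENNReal.tsum_le_tsum h1
  rw [← ENNReal.ofReal_tsum_of_nonneg (fun n => by positivity) hs.summable, hs.tsum_eq] at h2
  refine (add_le_add_right h2 _).trans ?_
  rw [lintegral_const, Measure.restrict_apply_univ, Real.volume_closedBall,
    show (16 : ENNReal) = ENNReal.ofReal 16 by simp, ← ENNReal.ofReal_mul (by norm_num),
    ← ENNReal.ofReal_add (by positivity) (by positivity)]
  apply ENNReal.ofReal_le_ofReal
  nlinarith [mul_le_mul he' he' he (by norm_num)]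

/-- The integral of `|e^(u - a) - 1|` over an interval, where `a` is the mean of `u`. -/
def expOsc (u : ℝ → ℂ) (x r : ℝ) : ENNReal :=
  ∫⁻ t in closedBall x r, ‖Complex.exp (u t - mean u x r) - 1‖ₑ

/-- Cauchy-Schwarz applied to |e^w - 1| ≤ |w| e^|w| with w = u - a: the exponential factor is
controlled by `lintegral_exp_norm_sub_mean_le`, the other factor by the local energy. -/
lemma expOsc_sq_le {u : ℝ → ℂ} (hm : Measurable u)
    (hu : LocallyIntegrable u volume) {e : ℝ} (he : 0 ≤ e) (he' : e ≤ 1 / 40)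
    (hE : energy u ≤ ENNReal.ofReal (e ^ 2)) {x r : ℝ} (hr : 0 < r) :
    expOsc u x r ^ 2 ≤ 20 * localEnergy u x r := by
  have h1 : expOsc u x r ≤ ∫⁻ t in closedBall x r, ‖u t - mean u x r‖ₑ *
      ENNReal.ofReal (Real.exp ‖u t - mean u x r‖) := by
    refine lintegral_mono fun t => ?_
    have h := Complex.norm_exp_sub_sum_le_norm_mul_exp (u t - mean u x r) 1
    simp only [Finset.range_one, Finset.sum_singleton, pow_zero, Nat.factorial_zero, Nat.cast_one,
      div_one, pow_one] at h
    simp only [← ofReal_norm]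
    rw [← ENNReal.ofReal_mul (norm_nonneg _)]
    exact ENNReal.ofReal_le_ofReal h
  have h2 := sq_lintegral_mul_le (μ := volume.restrict (closedBall x r))
    (f := fun t => ‖u t - mean u x r‖ₑ)
    (g := fun t => ENNReal.ofReal (Real.exp ‖u t - mean u x r‖))
    (by fun_prop) (by fun_prop)
  have h3 : ∀ t, ENNReal.ofReal (Real.exp ‖u t - mean u x r‖) ^ 2 =
      ENNReal.ofReal (Real.exp (2 * ‖u t - mean u x r‖)) := fun t => by
    rw [← ENNReal.ofReal_pow (Real.exp_pos _).le, ← Real.exp_nat_mul]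
    norm_num
  simp only [h3] at h2
  have h4 := lintegral_exp_norm_sub_mean_le hm hu he he' hE (x₀ := x) hr
  have h5 := lintegral_sub_mean_sq_le hu hr (subset_refl (closedBall x r)) subset_rfl
  calc expOsc u x r ^ 2 ≤ _ := pow_le_pow_left' h1 2
    _ ≤ _ := h2
    _ ≤ (∫⁻ t in closedBall x r, ‖u t - mean u x r‖ₑ ^ 2) * ENNReal.ofReal (40 * r) := by gcongr
    _ = 20 * ((∫⁻ t in closedBall x r, ‖u t - mean u x r‖ₑ ^ 2) * ENNReal.ofReal (2 * r)) := by
      rw [show 40 * r = 20 * (2 * r) by ring, ENNReal.ofReal_mul (by norm_num)]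
      simp only [ENNReal.ofReal_ofNat]
      ring
    _ ≤ _ := by gcongr

lemma expOsc_le {u : ℝ → ℂ} (hm : Measurable u)
    (hu : LocallyIntegrable u volume) {e : ℝ} (he : 0 ≤ e) (he' : e ≤ 1 / 40)
    (hE : energy u ≤ ENNReal.ofReal (e ^ 2)) {x r : ℝ} (hr : 0 < r) :
    expOsc u x r ≤ ENNReal.ofReal (9 * e * r) := by
  have h1 := (expOsc_sq_le hm hu he he' hE (x := x) hr).trans
    (mul_le_mul_right ((localEnergy_le u x r).trans (mul_le_mul_right hE _)) _)
  rw [show (20 : ENNReal) = ENNReal.ofReal 20 by simp, ← ENNReal.ofReal_mul (by positivity),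
    ← ENNReal.ofReal_mul (by positivity)] at h1
  have h2 : expOsc u x r ^ 2 ≤ ENNReal.ofReal (9 * e * r) ^ 2 := by
    rw [← ENNReal.ofReal_pow (by positivity)]
    exact h1.trans (ENNReal.ofReal_le_ofReal (by nlinarith [sq_nonneg (e * r)]))
  exact (ENNReal.pow_right_strictMono two_ne_zero).le_iff_le.1 h2

lemma integrableOn_exp_sub_mean {u : ℝ → ℂ} (hm : Measurable u)
    (hu : LocallyIntegrable u volume) {e : ℝ} (he : 0 ≤ e) (he' : e ≤ 1 / 40)
    (hE : energy u ≤ ENNReal.ofReal (e ^ 2)) {x r : ℝ} (hr : 0 < r) :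
    IntegrableOn (fun t => Complex.exp (u t - mean u x r) - 1) (closedBall x r) :=
  ⟨by fun_prop, (expOsc_le hm hu he he' hE hr).trans_lt ENNReal.ofReal_lt_top⟩

lemma locallyIntegrable_exp {u : ℝ → ℂ} (hm : Measurable u)
    (hu : LocallyIntegrable u volume) {e : ℝ} (he : 0 ≤ e) (he' : e ≤ 1 / 40)
    (hE : energy u ≤ ENNReal.ofReal (e ^ 2)) :
    LocallyIntegrable (fun t => Complex.exp (u t)) volume := by
  intro x
  refine ⟨closedBall x 1, closedBall_mem_nhds x one_pos, ?_⟩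
  have h1 := (integrableOn_exp_sub_mean hm hu he he' hE (x := x) one_pos).add
    (integrableOn_const (C := (1 : ℂ)) measure_closedBall_lt_top.ne)
  refine (h1.const_mul (Complex.exp (mean u x 1))).congr (Eventually.of_forall fun t => ?_)
  simp only [Pi.add_apply, sub_add_cancel, ← Complex.exp_add, add_sub_cancel]

/-! ### The extension by convolution -/

/-- The map `x + iy ↦ ∫ K(s) γ(x - ys) ds`. -/
def kernelExt (K : ℝ → ℂ) (γ : ℝ → ℂ) (z : ℂ) : ℂ := ∫ s, K s * γ (z.re - z.im * s)

/-- Continuous kernels, supported on `[-1, 1]` and bounded by `M`, for which the extension of the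
identity of the line is the identity of the plane. -/
structure IsKernel (K : ℝ → ℂ) (M : ℝ) : Prop where
  continuous : Continuous K
  support : ∀ s, s ∉ Icc (-1 : ℝ) 1 → K s = 0
  bound : ∀ s, ‖K s‖ ≤ M
  integral : ∫ s, K s = 1
  integral_mul_id : ∫ s, K s * s = -Complex.I

/-- The complex kernel `φ - iψ` of a Semmes pair. -/
def semmesKernel (φ ψ : ℝ → ℝ) (s : ℝ) : ℂ := φ s - Complex.I * ψ s

lemma hasCompactSupport_of_support_subset {E : Type*} [Zero E] {f : ℝ → E}
    (hf : ∀ s, s ∉ Icc (-1 : ℝ) 1 → f s = 0) : HasCompactSupport f :=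
  HasCompactSupport.intro isCompact_Icc hf

lemma integrable_mul_of_support {f g : ℝ → ℂ} (hf : Continuous f) (hg : Continuous g)
    (h : ∀ s, s ∉ Icc (-1 : ℝ) 1 → f s = 0) : Integrable fun s => f s * g s :=
  (hf.mul hg).integrable_of_hasCompactSupport
    (hasCompactSupport_of_support_subset fun s hs => by simp [h s hs])

lemma integral_eq_zero_of_odd {f : ℝ → ℝ} (hf : Function.Odd f) : ∫ x, f x = 0 := by
  have h : ∫ x, f (-x) = ∫ x, f x := integral_neg_eq_self f volume
  simp only [hf _, integral_neg] at h
  linarith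

/-- Parity removes ∫ ψ and ∫ sφ(s) ds; the two normalizations give the remaining moments 1 and -i.
-/
lemma IsSemmesPair.exists_isKernel {φ ψ : ℝ → ℝ} (h : IsSemmesPair φ ψ) :
    ∃ M, 0 < M ∧ IsKernel (semmesKernel φ ψ) M := by
  have hφ := h.smooth_even.continuous
  have hψ := h.smooth_odd.continuous
  have hφ0 : ∀ s, s ∉ Icc (-1 : ℝ) 1 → φ s = 0 := fun s hs => by
    by_contra h0; exact hs (h.support_even h0)
  have hψ0 : ∀ s, s ∉ Icc (-1 : ℝ) 1 → ψ s = 0 := fun s hs => by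
    by_contra h0; exact hs (h.support_odd h0)
  have hc : Continuous (semmesKernel φ ψ) := by unfold semmesKernel; fun_prop
  have hs : ∀ s, s ∉ Icc (-1 : ℝ) 1 → semmesKernel φ ψ s = 0 := fun s hs => by
    simp [semmesKernel, hφ0 s hs, hψ0 s hs]
  have hiφ : Integrable φ :=
    hφ.integrable_of_hasCompactSupport (hasCompactSupport_of_support_subset hφ0)
  have hiψ : Integrable ψ :=
    hψ.integrable_of_hasCompactSupport (hasCompactSupport_of_support_subset hψ0)
  have hiφ' : Integrable fun s => φ s * s := (hφ.mul continuous_id).integrable_of_hasCompactSupport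
    (hasCompactSupport_of_support_subset fun s hs => by simp [hφ0 s hs])
  have hiψ' : Integrable fun s => ψ s * s := (hψ.mul continuous_id).integrable_of_hasCompactSupport
    (hasCompactSupport_of_support_subset fun s hs => by simp [hψ0 s hs])
  obtain ⟨M, hM⟩ := hc.bounded_above_of_compact_support (hasCompactSupport_of_support_subset hs)
  refine ⟨max M 1, by positivity, hc, hs, fun s => (hM s).trans (le_max_left _ _), ?_, ?_⟩
  · unfold semmesKernel
    rw [integral_sub hiφ.ofReal (hiψ.ofReal.const_mul _), integral_const_mul, integral_complex_ofReal,
      integral_complex_ofReal, h.integral_even, integral_eq_zero_of_odd h.odd]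
    simp
  · have : ∀ s : ℝ, semmesKernel φ ψ s * s =
        ((φ s * s : ℝ) : ℂ) - Complex.I * ((ψ s * s : ℝ) : ℂ) := fun s => by
      simp only [semmesKernel]; push_cast; ring
    simp only [this]
    rw [integral_sub hiφ'.ofReal (hiψ'.ofReal.const_mul _), integral_const_mul,
      integral_complex_ofReal, integral_complex_ofReal, h.integral_odd, integral_eq_zero_of_odd]
    · simp
    · intro s
      simp [h.even s]

lemma convScale_eq {φ : ℝ → ℝ} {y : ℝ} (hy : 0 < y) (γ : ℝ → ℂ) (x : ℝ) :
    convScale φ y γ x = ∫ s, (φ s : ℂ) * γ (x - y * s) := by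
  let g : ℝ → ℂ := fun s => (φ s : ℂ) * γ (x - y * s)
  have h1 : ∀ t, ((y⁻¹ * φ (y⁻¹ * (x - t)) : ℝ) : ℂ) * γ t = y⁻¹ • g (y⁻¹ * (x - t)) := by
    intro t
    simp only [g, Complex.real_smul]
    rw [mul_inv_cancel_left₀ hy.ne', sub_sub_cancel]
    push_cast; ring
  unfold convScale
  simp only [h1]
  rw [integral_smul, integral_sub_left_eq_self (fun t => g (y⁻¹ * t)) volume x,
    Measure.integral_comp_mul_left, smul_smul, inv_inv, abs_of_pos hy, inv_mul_cancel₀ hy.ne',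
    one_smul]

lemma convScale_sub_eq_kernelExt {φ ψ : ℝ → ℝ} (h : IsSemmesPair φ ψ) {γ : ℝ → ℂ}
    (hγ : Continuous γ) {z : ℂ} (hz : 0 < z.im) :
    convScale φ z.im γ z.re - Complex.I * convScale ψ z.im γ z.re =
      kernelExt (semmesKernel φ ψ) γ z := by
  have hφ := h.smooth_even.continuous
  have hψ := h.smooth_odd.continuous
  have h1 : Integrable fun s => (φ s : ℂ) * γ (z.re - z.im * s) :=
    integrable_mul_of_support (by fun_prop) (by fun_prop) fun s hs => by
      by_contra h0; exact hs (h.support_even fun h1 => h0 (by simp [h1]))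
  have h2 : Integrable fun s => (ψ s : ℂ) * γ (z.re - z.im * s) :=
    integrable_mul_of_support (by fun_prop) (by fun_prop) fun s hs => by
      by_contra h0; exact hs (h.support_odd fun h1 => h0 (by simp [h1]))
  rw [convScale_eq hz, convScale_eq hz, ← integral_const_mul, ← integral_sub h1 (h2.const_mul _)]
  refine integral_congr_ae (Eventually.of_forall fun s => ?_)
  simp only [semmesKernel]; ring

lemma IsKernel.integrable_mul {K : ℝ → ℂ} {M : ℝ} (hK : IsKernel K M) {g : ℝ → ℂ}
    (hg : Continuous g) : Integrable fun s => K s * g s :=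
  integrable_mul_of_support hK.continuous hg hK.support

lemma IsKernel.kernelExt_ofReal {K : ℝ → ℂ} {M : ℝ} (hK : IsKernel K M) (γ : ℝ → ℂ) (x : ℝ) :
    kernelExt K γ x = γ x := by
  simp [kernelExt, integral_mul_const, hK.integral]

lemma IsKernel.integral_mul_affine {K : ℝ → ℂ} {M : ℝ} (hK : IsKernel K M) (z : ℂ) :
    ∫ s, K s * ((z.re - z.im * s : ℝ) : ℂ) = z := by
  have h : ∀ s, K s * ((z.re - z.im * s : ℝ) : ℂ) = K s * z.re - z.im * (K s * s) := fun s => by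
    push_cast; ring
  simp only [h]
  rw [integral_sub (hK.integrable_mul continuous_const)
    ((hK.integrable_mul (g := fun s => (s : ℂ)) (by fun_prop)).const_mul _), integral_mul_const,
    integral_const_mul, hK.integral, hK.integral_mul_id]
  conv_rhs => rw [← Complex.re_add_im z]
  ring

lemma volume_inter_le {t x y d : ℝ} (hy : 0 < y) :
    volume ({s : ℝ | |t - (x - y * s)| ≤ 2 * d} ∩ Icc (-1) 1) ≤
      ENNReal.ofReal (min 2 (4 * d / y)) := by
  rw [ENNReal.ofReal_min]
  refine le_min ((measure_mono inter_subset_right).trans ?_)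
    ((measure_mono inter_subset_left).trans ?_)
  · rw [Real.volume_Icc]; norm_num
  · have : {s : ℝ | |t - (x - y * s)| ≤ 2 * d} = closedBall ((x - t) / y) (2 * d / y) := by
      ext s
      have h1 : t - (x - y * s) = (s - (x - t) / y) * y := by field_simp; ring
      rw [mem_ofPred_eq, mem_closedBall, Real.dist_eq, le_div_iff₀ hy, h1, abs_mul, abs_of_pos hy]
    rw [this, Real.volume_closedBall]
    apply le_of_eq; congr 1; ring

/-- Since K reproduces affine maps, the left side is an integral of K(s) times the integral of v
between the points of parameter s belonging to w and z. For |s| ≤ 1 these points are at distance at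
most 2|z - w|. After exchanging integrals, a given t is met only for s in a set of measure at most
min(2, 4|z - w| / Im z). -/
lemma IsKernel.enorm_kernelExt_sub_le {K : ℝ → ℂ} {M : ℝ} (hK : IsKernel K M) {γ v : ℝ → ℂ}
    (hγ : Continuous γ) (hv : Measurable v) {p r : ℝ} {κ : ℂ}
    (h : ∀ s ∈ closedBall p r, ∀ t ∈ closedBall p r, γ t - γ s - κ * (t - s) = ∫ x in s..t, v x)
    {z w : ℂ} (hz : 0 < z.im) (hw : 0 ≤ w.im) (hzB : closedBall z.re z.im ⊆ closedBall p r)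
    (hwB : closedBall w.re w.im ⊆ closedBall p r) :
    ‖kernelExt K γ z - kernelExt K γ w - κ * (z - w)‖ₑ ≤
      ENNReal.ofReal (M * min 2 (4 * ‖z - w‖ / z.im)) * ∫⁻ t in closedBall p r, ‖v t‖ₑ := by
  have hM : 0 ≤ M := (norm_nonneg _).trans (hK.bound 0)
  set d := ‖z - w‖ with hd
  have hi : ∀ z : ℂ, Integrable fun s => K s * γ (z.re - z.im * s) := fun z =>
    hK.integrable_mul (by fun_prop)
  have hi' : ∀ z : ℂ, Integrable fun s => K s * ((z.re - z.im * s : ℝ) : ℂ) := fun z =>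
    hK.integrable_mul (by fun_prop)
  have h1 : kernelExt K γ z - kernelExt K γ w - κ * (z - w) =
      ∫ s, K s * (γ (z.re - z.im * s) - γ (w.re - w.im * s) -
        κ * (((z.re - z.im * s : ℝ) : ℂ) - ((w.re - w.im * s : ℝ) : ℂ))) := by
    have hA : Integrable fun s => K s * γ (z.re - z.im * s) - K s * γ (w.re - w.im * s) :=
      (hi z).sub (hi w)
    have hB : Integrable fun s => κ * (K s * ((z.re - z.im * s : ℝ) : ℂ) -
        K s * ((w.re - w.im * s : ℝ) : ℂ)) := ((hi' z).sub (hi' w)).const_mul _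
    have h0 : κ * (z - w) = κ * ((∫ s, K s * ((z.re - z.im * s : ℝ) : ℂ)) -
        ∫ s, K s * ((w.re - w.im * s : ℝ) : ℂ)) := by
      rw [hK.integral_mul_affine z, hK.integral_mul_affine w]
    rw [h0, kernelExt, kernelExt,
      ← integral_sub (hi z) (hi w), ← integral_sub (hi' z) (hi' w), ← integral_const_mul,
      ← integral_sub hA hB]
    refine integral_congr_ae (Eventually.of_forall fun s => ?_)
    dsimp only
    ring
  let A : Set (ℝ × ℝ) := {q | |q.2 - (z.re - z.im * q.1)| ≤ 2 * d}
  have hA : MeasurableSet A := (isClosed_le (f := fun q : ℝ × ℝ => |q.2 - (z.re - z.im * q.1)|)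
    (g := fun _ => 2 * d) (by fun_prop) (by fun_prop)).measurableSet
  have hF : Measurable (A.indicator fun q => ‖v q.2‖ₑ) := Measurable.indicator (by fun_prop) hA
  have h2 : ∀ s, ‖K s * (γ (z.re - z.im * s) - γ (w.re - w.im * s) -
        κ * (((z.re - z.im * s : ℝ) : ℂ) - ((w.re - w.im * s : ℝ) : ℂ)))‖ₑ ≤
      (Icc (-1) 1).indicator (fun s => ENNReal.ofReal M *
        ∫⁻ t in closedBall p r, A.indicator (fun q => ‖v q.2‖ₑ) (s, t)) s := by
    intro s
    by_cases hs : s ∈ Icc (-1 : ℝ) 1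
    · rw [indicator_of_mem hs, enorm_mul]
      gcongr
      · rw [← ofReal_norm]; exact ENNReal.ofReal_le_ofReal (hK.bound s)
      · have hmem : ∀ z : ℂ, 0 ≤ z.im → z.re - z.im * s ∈ closedBall z.re z.im := by
          intro z hz
          rw [mem_closedBall, Real.dist_eq, sub_sub_cancel_left, abs_neg, abs_mul, abs_of_nonneg hz]
          exact mul_le_of_le_one_right hz (abs_le.2 hs)
        have hzs := hzB (hmem z hz.le)
        have hws := hwB (hmem w hw)
        have hre := Complex.abs_re_le_norm (z - w)
        have him := Complex.abs_im_le_norm (z - w)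
        rw [Complex.sub_re, ← hd] at hre
        rw [Complex.sub_im, ← hd] at him
        have hdist : |(w.re - w.im * s) - (z.re - z.im * s)| ≤ 2 * d := by
          have h3 : (w.re - w.im * s) - (z.re - z.im * s) =
            -(z.re - w.re) + (z.im - w.im) * s := by ring
          rw [h3]
          refine (abs_add_le _ _).trans ?_
          rw [abs_neg, abs_mul]
          have := mul_le_mul him (abs_le.2 hs) (abs_nonneg _) (norm_nonneg _)
          linarith
        rw [h _ hws _ hzs, ← ofReal_norm, intervalIntegral.norm_integral_eq_norm_integral_uIoc,
          ofReal_norm]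
        refine (enorm_integral_le_lintegral_enorm _).trans ?_
        rw [← lintegral_indicator measurableSet_uIoc, ← lintegral_indicator measurableSet_closedBall]
        refine lintegral_mono fun t => ?_
        by_cases ht : t ∈ uIoc (w.re - w.im * s) (z.re - z.im * s)
        · have ht' := uIoc_subset_uIcc ht
          have h4 : t ∈ closedBall p r := by
            have : OrdConnected (closedBall p r) := by
              rw [Real.closedBall_eq_Icc]; exact ordConnected_Icc
            exact this.uIcc_subset hws hzs ht'
          have h5 : (s, t) ∈ A := by
            have := abs_sub_left_of_mem_uIcc (uIcc_comm (w.re - w.im * s) _ ▸ ht')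
            exact this.trans hdist
          rw [indicator_of_mem ht, indicator_of_mem h4, indicator_of_mem h5]
        · rw [indicator_of_notMem ht]; exact zero_le
    · rw [hK.support s hs]; simp
  rw [h1]
  refine (enorm_integral_le_lintegral_enorm _).trans ((lintegral_mono h2).trans ?_)
  rw [lintegral_indicator measurableSet_Icc, lintegral_const_mul' _ _ ENNReal.ofReal_ne_top,
    lintegral_lintegral_swap (f := fun s t => A.indicator (fun q => ‖v q.2‖ₑ) (s, t))
      hF.aemeasurable, ENNReal.ofReal_mul hM, mul_assoc]
  gcongr
  rw [← lintegral_const_mul' _ _ ENNReal.ofReal_ne_top]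
  refine lintegral_mono fun t => ?_
  have h3 : ∀ s, A.indicator (fun q => ‖v q.2‖ₑ) (s, t) =
      {s : ℝ | |t - (z.re - z.im * s)| ≤ 2 * d}.indicator (fun _ => ‖v t‖ₑ) s := fun s => rfl
  simp only [h3]
  have h6 : MeasurableSet {s : ℝ | |t - (z.re - z.im * s)| ≤ 2 * d} :=
    (isClosed_le (f := fun s : ℝ => |t - (z.re - z.im * s)|) (g := fun _ => 2 * d)
      (by fun_prop) (by fun_prop)).measurableSet
  rw [lintegral_indicator_const h6, Measure.restrict_apply h6, mul_comm]
  gcongr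
  exact volume_inter_le hz

/-! ### Primitives of exponentials of functions of small energy -/

/-- `u` is measurable, locally integrable, and of energy at most `e²` for a small number `e`. -/
structure IsSmall (u : ℝ → ℂ) (e : ℝ) : Prop where
  measurable : Measurable u
  locallyIntegrable : LocallyIntegrable u volume
  nonneg : 0 ≤ e
  le : e ≤ 1 / 40
  energy_le : energy u ≤ ENNReal.ofReal (e ^ 2)

/-- `γ` is a primitive of `c e^u`. -/
def IsExpPrimitive (c : ℂ) (u γ : ℝ → ℂ) : Prop :=
  ∀ s t : ℝ, γ t - γ s = c * ∫ x in s..t, Complex.exp (u x)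

/-- The number `c e^a`, where `a` is the mean of `u`: the reference slope of primitives of `c e^u`. -/
def slope (c : ℂ) (u : ℝ → ℂ) (p r : ℝ) : ℂ := c * Complex.exp (mean u p r)

/-- The average oscillation of `e^u` relative to its reference slope. -/
def relOsc (u : ℝ → ℂ) (p r : ℝ) : ℝ := (expOsc u p r).toReal / r

variable {u γ K : ℝ → ℂ} {e M : ℝ} {c : ℂ} {f h : ℝ → ℝ}

lemma IsSmall.expOsc_le (hu : IsSmall u e) {p r : ℝ} (hr : 0 < r) :
    expOsc u p r ≤ ENNReal.ofReal (9 * e * r) :=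
  WeilPetersson.expOsc_le hu.measurable hu.locallyIntegrable hu.nonneg hu.le hu.energy_le hr

lemma IsSmall.expOsc_eq (hu : IsSmall u e) {p r : ℝ} (hr : 0 < r) :
    expOsc u p r = ENNReal.ofReal (relOsc u p r * r) := by
  rw [relOsc, div_mul_cancel₀ _ hr.ne', ENNReal.ofReal_toReal]
  exact ((hu.expOsc_le hr).trans_lt ENNReal.ofReal_lt_top).ne

lemma relOsc_nonneg (u : ℝ → ℂ) (p : ℝ) {r : ℝ} (hr : 0 < r) : 0 ≤ relOsc u p r := by
  unfold relOsc; positivity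

lemma IsSmall.relOsc_le (hu : IsSmall u e) (p : ℝ) {r : ℝ} (hr : 0 < r) :
    relOsc u p r ≤ 9 * e := by
  rw [relOsc, div_le_iff₀ hr]
  exact ENNReal.toReal_le_of_le_ofReal (by have := hu.nonneg; positivity) (hu.expOsc_le hr)

lemma IsSmall.ofReal_relOsc_sq_le (hu : IsSmall u e) (p : ℝ) {r : ℝ} (hr : 0 < r) :
    ENNReal.ofReal (relOsc u p r ^ 2) ≤ ENNReal.ofReal (20 / r ^ 2) * localEnergy u p r := by
  have h := expOsc_sq_le hu.measurable hu.locallyIntegrable hu.nonneg hu.le hu.energy_le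
    (x := p) hr
  rw [hu.expOsc_eq hr, ← ENNReal.ofReal_pow (mul_nonneg (relOsc_nonneg u p hr) hr.le)] at h
  have h1 := mul_le_mul_right h (ENNReal.ofReal (1 / r ^ 2))
  rw [← ENNReal.ofReal_mul (by positivity)] at h1
  convert h1 using 1
  · congr 1; field_simp
  · rw [show (20 : ENNReal) = ENNReal.ofReal 20 by simp, ← mul_assoc,
      ← ENNReal.ofReal_mul (by positivity)]
    congr 2; ring

lemma IsSmall.locallyIntegrable_exp (hu : IsSmall u e) :
    LocallyIntegrable (fun t => Complex.exp (u t)) volume :=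
  WeilPetersson.locallyIntegrable_exp hu.measurable hu.locallyIntegrable hu.nonneg hu.le
    hu.energy_le

lemma IsSmall.continuous (hu : IsSmall u e) (hγ : IsExpPrimitive c u γ) : Continuous γ := by
  have h : γ = fun t => γ 0 + c * ∫ x in (0 : ℝ)..t, Complex.exp (u x) := by
    ext t; rw [← hγ 0 t]; ring
  rw [h]
  have := intervalIntegral.continuous_primitive (μ := volume)
    (fun a b => (hu.locallyIntegrable_exp.integrableOn_isCompact isCompact_uIcc).intervalIntegrable) 0
  fun_prop

lemma IsSmall.primitive_sub_eq (hu : IsSmall u e) (hγ : IsExpPrimitive c u γ) (p r s t : ℝ) :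
    γ t - γ s - slope c u p r * (t - s) =
      ∫ x in s..t, slope c u p r * (Complex.exp (u x - mean u p r) - 1) := by
  have hi : IntervalIntegrable (fun t => Complex.exp (u t)) volume s t :=
    (hu.locallyIntegrable_exp.integrableOn_isCompact isCompact_uIcc).intervalIntegrable
  have h1 : ∀ x, slope c u p r * (Complex.exp (u x - mean u p r) - 1) =
      c * Complex.exp (u x) - slope c u p r := fun x => by
    rw [mul_sub, mul_one, slope, mul_assoc, ← Complex.exp_add, add_sub_cancel]
  simp only [h1]
  rw [intervalIntegral.integral_sub (hi.const_mul c) (by simp),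
    intervalIntegral.integral_const_mul, ← hγ s t, intervalIntegral.integral_const,
    Complex.real_smul, Complex.ofReal_sub]
  ring

lemma IsSmall.norm_kernelExt_sub_le (hu : IsSmall u e) (hγ : IsExpPrimitive c u γ)
    (hK : IsKernel K M) {p r : ℝ} (hr : 0 < r) {z w : ℂ} (hz : 0 < z.im) (hw : 0 ≤ w.im)
    (hzB : closedBall z.re z.im ⊆ closedBall p r) (hwB : closedBall w.re w.im ⊆ closedBall p r) :
    ‖kernelExt K γ z - kernelExt K γ w - slope c u p r * (z - w)‖ ≤
      M * min 2 (4 * ‖z - w‖ / z.im) * (‖slope c u p r‖ * (relOsc u p r * r)) := by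
  have hM : 0 ≤ M := (norm_nonneg _).trans (hK.bound 0)
  have hm := hu.measurable
  have h := hK.enorm_kernelExt_sub_le (hu.continuous hγ)
    (v := fun t => slope c u p r * (Complex.exp (u t - mean u p r) - 1)) (by fun_prop)
    (p := p) (r := r) (κ := slope c u p r) ?_ hz hw hzB hwB
  · simp only [enorm_mul] at h
    rw [lintegral_const_mul' _ _ enorm_ne_top] at h
    change _ ≤ _ * (_ * expOsc u p r) at h
    rw [hu.expOsc_eq hr, ← ofReal_norm, ← ofReal_norm, ← ENNReal.ofReal_mul (norm_nonneg _),
      ← ENNReal.ofReal_mul (by positivity), ENNReal.ofReal_le_ofReal_iff] at h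
    · exact h
    · have := relOsc_nonneg u p hr
      positivity
  · exact fun s _ t _ => hu.primitive_sub_eq hγ p r s t

/-! ### Maps close to similarities -/

/-- On the set `s`, the map `f` differs from multiplication by `κ ≠ 0` by a map with Lipschitz
constant `η |κ|`. -/
structure IsNearSimilarityOn (f : ℂ → ℂ) (κ : ℂ) (η : ℝ) (s : Set ℂ) : Prop where
  ne_zero : κ ≠ 0
  nonneg : 0 ≤ η
  norm_le : ∀ z ∈ s, ∀ w ∈ s, ‖f z - f w - κ * (z - w)‖ ≤ η * ‖κ‖ * ‖z - w‖

namespace IsNearSimilarityOn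

variable {f : ℂ → ℂ} {κ z : ℂ} {η : ℝ} {s : Set ℂ}

lemma exists_lipschitzOnWith (h : IsNearSimilarityOn f κ η s) : ∃ C, LipschitzOnWith C f s := by
  have h0 := h.nonneg
  refine ⟨Real.toNNReal ((1 + η) * ‖κ‖), LipschitzOnWith.of_dist_le_mul fun z hz w hw => ?_⟩
  rw [dist_eq_norm, dist_eq_norm, Real.coe_toNNReal _ (by positivity)]
  have h1 := h.norm_le z hz w hw
  have h2 := norm_add_le (f z - f w - κ * (z - w)) (κ * (z - w))
  rw [sub_add_cancel, norm_mul] at h2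
  linarith

/-- Divided by κ, the map is a perturbation of the identity with Lipschitz constant η < 1, so the
Lipschitz form of the inverse function theorem applies. -/
lemma map_nhds_eq (h : IsNearSimilarityOn f κ η s) (hη : η < 1) (hs : s ∈ 𝓝 z) :
    map f (𝓝 z) = 𝓝 (f z) := by
  let g : ℂ → ℂ := fun z => κ⁻¹ * f z
  have hκ : 0 < ‖κ‖ := norm_pos_iff.2 h.ne_zero
  have hg : ApproximatesLinearOn g (ContinuousLinearEquiv.refl ℂ ℂ : ℂ →L[ℂ] ℂ) s
      (Real.toNNReal η) := by
    intro z hz w hw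
    rw [Real.coe_toNNReal _ h.nonneg]
    have e : g z - g w - (ContinuousLinearEquiv.refl ℂ ℂ : ℂ →L[ℂ] ℂ) (z - w) =
        κ⁻¹ * (f z - f w - κ * (z - w)) := by
      simp only [g, ContinuousLinearEquiv.coe_refl, ContinuousLinearMap.coe_id', id_eq]
      rw [mul_sub κ⁻¹, inv_mul_cancel_left₀ h.ne_zero]
      ring
    rw [e, norm_mul, norm_inv, inv_mul_le_iff₀ hκ]
    linarith [h.norm_le z hz w hw]
  have h1 : map g (𝓝 z) = 𝓝 (g z) := hg.map_nhds_eq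
      (ContinuousLinearEquiv.refl ℂ ℂ).toNonlinearRightInverse hs (Or.inr ?_)
  swap
  · have e : (ContinuousLinearEquiv.refl ℂ ℂ).toNonlinearRightInverse.nnnorm =
      ‖((ContinuousLinearEquiv.refl ℂ ℂ).symm : ℂ →L[ℂ] ℂ)‖₊ := rfl
    have e2 : ‖((ContinuousLinearEquiv.refl ℂ ℂ).symm : ℂ →L[ℂ] ℂ)‖₊ = 1 :=
      ContinuousLinearMap.nnnorm_id
    rw [e, e2, inv_one, Real.toNNReal_lt_one]
    exact hη
  have hf : f = (Homeomorph.mulLeft₀ κ h.ne_zero) ∘ g := by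
    ext w; simp [g, h.ne_zero]
  rw [hf, ← Filter.map_map, h1]
  exact (Homeomorph.mulLeft₀ κ h.ne_zero).map_nhds_eq _

lemma norm_fderiv_sub_le (h : IsNearSimilarityOn f κ η s) (hs : s ∈ 𝓝 z)
    (hd : DifferentiableAt ℝ f z) :
    ∃ G : ℂ →L[ℝ] ℂ, ‖G‖ ≤ η * ‖κ‖ ∧ ∀ v, lineDeriv ℝ f z v = G v + κ * v := by
  let g : ℂ → ℂ := fun z => f z - κ * z
  have hg : DifferentiableAt ℝ g z := by fun_prop
  refine ⟨fderiv ℝ g z, ?_, fun v => ?_⟩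
  · have h0 := h.nonneg
    refine norm_fderiv_le_of_lip' ℝ (by positivity) ?_
    filter_upwards [hs] with w hw
    have e : g w - g z = f w - f z - κ * (w - z) := by
      change f w - κ * w - (f z - κ * z) = _
      ring
    rw [e]
    exact h.norm_le w hw z (mem_of_mem_nhds hs)
  · rw [hd.lineDeriv_eq_fderiv]
    have h1 : HasFDerivAt f (fderiv ℝ g z + κ • (ContinuousLinearMap.id ℝ ℂ)) z := by
      have h2 := hg.hasFDerivAt.add ((hasFDerivAt_id (𝕜 := ℝ) z).const_mul κ)
      refine h2.congr_of_eventuallyEq (Eventually.of_forall fun w => ?_)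
      change f w = f w - κ * w + κ * w
      rw [sub_add_cancel]
    rw [h1.fderiv]
    simp

/-- Multiplication by κ contributes κ to ∂f and nothing to ∂̄f; the remainder has a derivative of
norm at most η|κ|. -/
lemma norm_dz_ge (h : IsNearSimilarityOn f κ η s) (hs : s ∈ 𝓝 z)
    (hd : DifferentiableAt ℝ f z) :
    (1 - η) * ‖κ‖ ≤ ‖dz f z‖ ∧ ‖dzbar f z‖ ≤ η * ‖κ‖ := by
  obtain ⟨G, hG, hl⟩ := h.norm_fderiv_sub_le hs hd
  have h1 : ‖G 1‖ ≤ η * ‖κ‖ := (G.le_opNorm 1).trans (by simpa using hG)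
  have h2 : ‖Complex.I * G Complex.I‖ ≤ η * ‖κ‖ := by
    rw [norm_mul, Complex.norm_I, one_mul]
    exact (G.le_opNorm _).trans (by simpa using hG)
  constructor
  · have e : κ = dz f z - (G 1 - Complex.I * G Complex.I) / 2 := by
      simp only [dz, hl]
      linear_combination (κ / 2) * Complex.I_mul_I
    have h3 : ‖κ‖ ≤ ‖dz f z‖ + ‖(G 1 - Complex.I * G Complex.I) / 2‖ := by
      conv_lhs => rw [e]
      exact norm_sub_le _ _
    have h4 := norm_sub_le (G 1) (Complex.I * G Complex.I)
    rw [norm_div, Complex.norm_two] at h3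
    linarith
  · have e : dzbar f z = (G 1 + Complex.I * G Complex.I) / 2 := by
      simp only [dzbar, hl]
      linear_combination (κ / 2) * Complex.I_mul_I
    rw [e, norm_div, Complex.norm_two]
    have h4 := norm_add_le (G 1) (Complex.I * G Complex.I)
    linarith

lemma norm_dzbar_le (h : IsNearSimilarityOn f κ η s) (hη : η ≤ 1 / 2) (hs : s ∈ 𝓝 z)
    (hd : DifferentiableAt ℝ f z) :
    ‖dzbar f z‖ ≤ 2 * η * ‖dz f z‖ ∧ ‖beltrami f z‖ ≤ 2 * η := by
  obtain ⟨h1, h2⟩ := h.norm_dz_ge hs hd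
  have h0 := h.nonneg
  have hκ : 0 < ‖κ‖ := norm_pos_iff.2 h.ne_zero
  have h3 : ‖κ‖ ≤ 2 * ‖dz f z‖ := by nlinarith
  have h4 : ‖dzbar f z‖ ≤ 2 * η * ‖dz f z‖ := by nlinarith
  refine ⟨h4, ?_⟩
  rw [beltrami, norm_div]
  exact div_le_of_le_mul₀ (norm_nonneg _) (by positivity) h4

end IsNearSimilarityOn

/-! ### Regularity of locally Lipschitz maps -/

lemma isACL_of_locallyLipschitzOn {f : ℂ → ℂ} {Ω : Set ℂ} (hf : LocallyLipschitzOn Ω f) :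
    IsACL f Ω := by
  intro a b c d hab hcd hΩ
  have hcomp : IsCompact (Icc a b ×ℂ Icc c d) := isCompact_Icc.reProdIm isCompact_Icc
  obtain ⟨C, hC⟩ := (hf.mono hΩ).exists_lipschitzOnWith_of_compact hcomp
  have h1 : ∀ y, LipschitzWith 1 fun x : ℝ => (⟨x, y⟩ : ℂ) := fun y =>
    LipschitzWith.of_dist_le_mul fun x x' => by
      simp [Complex.dist_eq_re_im, Real.dist_eq, Real.sqrt_sq_eq_abs]
  have h2 : ∀ x, LipschitzWith 1 fun y : ℝ => (⟨x, y⟩ : ℂ) := fun x =>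
    LipschitzWith.of_dist_le_mul fun y y' => by
      simp [Complex.dist_eq_re_im, Real.dist_eq, Real.sqrt_sq_eq_abs]
  refine ⟨Eventually.of_forall fun y hy => ?_, Eventually.of_forall fun x hx => ?_⟩
  · refine LipschitzOnWith.absolutelyContinuousOnInterval
      (K := C * 1) (hC.comp (h1 y).lipschitzOnWith fun x hx => ?_)
    rw [uIcc_of_le hab.le] at hx
    exact ⟨hx, hy⟩
  · refine LipschitzOnWith.absolutelyContinuousOnInterval
      (K := C * 1) (hC.comp (h2 x).lipschitzOnWith fun y hy => ?_)
    rw [uIcc_of_le hcd.le] at hy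
    exact ⟨hx, hy⟩

lemma ae_differentiableAt_of_locallyLipschitzOn {f : ℂ → ℂ} {Ω : Set ℂ} (hΩ : IsOpen Ω)
    (hf : LocallyLipschitzOn Ω f) : ∀ᵐ z ∂volume.restrict Ω, DifferentiableAt ℝ f z := by
  rw [ae_restrict_iff' hΩ.measurableSet, ae_iff]
  refine measure_null_of_locally_null _ fun z hz => ?_
  simp only [Classical.not_imp, mem_ofPred_eq] at hz
  obtain ⟨C, t, ht, hC⟩ := hf hz.1
  rw [hΩ.nhdsWithin_eq hz.1] at ht
  obtain ⟨t', ht't, ht'o, hzt'⟩ := _root_.mem_nhds_iff.1 ht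
  refine ⟨_, inter_mem_nhdsWithin _ (ht'o.mem_nhds hzt'), ?_⟩
  have h := (hC.mono ht't).ae_differentiableWithinAt_of_mem (μ := volume)
  rw [ae_iff] at h
  refine measure_mono_null (fun w hw => ?_) h
  simp only [Classical.not_imp, mem_ofPred_eq, mem_inter_iff] at hw ⊢
  exact ⟨hw.2, fun h => hw.1.2 (h.differentiableAt (ht'o.mem_nhds hw.2))⟩

/-- The Beltrami coefficient of a map that is differentiable almost everywhere is measurable. -/
lemma aestronglyMeasurable_beltrami {f : ℂ → ℂ} {μ : Measure ℂ}
    (hf : ∀ᵐ z ∂μ, DifferentiableAt ℝ f z) : AEStronglyMeasurable (beltrami f) μ := by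
  have hm : Measurable fun z => (fderiv ℝ f z 1 + Complex.I * fderiv ℝ f z Complex.I) / 2 /
      ((fderiv ℝ f z 1 - Complex.I * fderiv ℝ f z Complex.I) / 2) := by
    have := measurable_fderiv_apply_const ℝ f 1
    have := measurable_fderiv_apply_const ℝ f Complex.I
    fun_prop
  refine hm.aestronglyMeasurable.congr ?_
  filter_upwards [hf] with z hz
  simp only [beltrami, dz, dzbar, hz.lineDeriv_eq_fderiv]

/-! ### The extension of a primitive of an exponential -/

lemma slope_ne_zero (hc : c ≠ 0) (u : ℝ → ℂ) (p r : ℝ) : slope c u p r ≠ 0 :=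
  mul_ne_zero hc (Complex.exp_ne_zero _)

lemma isOpen_U : IsOpen U := UpperHalfPlane.isOpen_upperHalfPlaneSet

lemma IsKernel.nonneg (hK : IsKernel K M) : 0 ≤ M := (norm_nonneg _).trans (hK.bound 0)

lemma abs_re_sub_le (z w : ℂ) : |z.re - w.re| ≤ ‖z - w‖ := Complex.abs_re_le_norm (z - w)

lemma abs_im_sub_le (z w : ℂ) : |z.im - w.im| ≤ ‖z - w‖ := Complex.abs_im_le_norm (z - w)

/-- On this ball the heights are at least y₀/2, where y₀ = Im z₀, and all the intervals used lie
within 2y₀ of Re z₀. Thus 4|z - w| / Im z ≤ 8|z - w| / y₀, and the radius 2y₀ accounts for the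
factor 16. -/
lemma IsSmall.isNearSimilarityOn (hu : IsSmall u e) (hγ : IsExpPrimitive c u γ) (hc : c ≠ 0)
    (hK : IsKernel K M) {z₀ : ℂ} (hz₀ : 0 < z₀.im) :
    IsNearSimilarityOn (kernelExt K γ) (slope c u z₀.re (2 * z₀.im))
      (16 * M * relOsc u z₀.re (2 * z₀.im)) (ball z₀ (z₀.im / 2)) := by
  have hM := hK.nonneg
  have ho := relOsc_nonneg u z₀.re (r := 2 * z₀.im) (by positivity)
  refine ⟨slope_ne_zero hc _ _ _, by positivity, fun z hz w hw => ?_⟩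
  have hprop : ∀ z ∈ ball z₀ (z₀.im / 2), z₀.im / 2 ≤ z.im ∧
      closedBall z.re z.im ⊆ closedBall z₀.re (2 * z₀.im) := by
    intro z hz
    rw [mem_ball, dist_eq_norm] at hz
    have h1 := abs_le.1 ((abs_im_sub_le z z₀).trans hz.le)
    have h2 := (abs_re_sub_le z z₀).trans hz.le
    refine ⟨by linarith [h1.1], closedBall_subset_closedBall' ?_⟩
    rw [Real.dist_eq]
    linarith [h1.2]
  obtain ⟨hz1, hz2⟩ := hprop z hz
  obtain ⟨hw1, hw2⟩ := hprop w hw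
  refine (hu.norm_kernelExt_sub_le hγ hK (by positivity) (by linarith) (by linarith)
    hz2 hw2).trans ?_
  have h1 : min 2 (4 * ‖z - w‖ / z.im) ≤ 8 * ‖z - w‖ / z₀.im := by
    refine (min_le_right _ _).trans ?_
    rw [div_le_div_iff₀ (by linarith) hz₀]
    nlinarith [norm_nonneg (z - w)]
  calc _ ≤ M * (8 * ‖z - w‖ / z₀.im) * (‖slope c u z₀.re (2 * z₀.im)‖ *
        (relOsc u z₀.re (2 * z₀.im) * (2 * z₀.im))) := by gcongr
    _ = _ := by field_simp; ring

/-- The radius Im z + 2|z - w| covers the base intervals of both points. The two entries of the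
minimum handle close and distant pairs, so the error is linear in |z - w| at every scale, down to
points w on the real line. -/
lemma IsSmall.norm_kernelExt_sub_slope_le (hu : IsSmall u e) (hγ : IsExpPrimitive c u γ)
    (hK : IsKernel K M) {z w : ℂ} (hz : 0 < z.im) (hw : 0 ≤ w.im) (hwz : w.im ≤ z.im) :
    ‖kernelExt K γ z - kernelExt K γ w - slope c u z.re (z.im + 2 * ‖z - w‖) * (z - w)‖ ≤
      72 * (M * e) * (‖slope c u z.re (z.im + 2 * ‖z - w‖)‖ * ‖z - w‖) := by
  have hM := hK.nonneg
  have he := hu.nonneg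
  set d := ‖z - w‖ with hd
  have hd0 : 0 ≤ d := norm_nonneg _
  have hr : 0 < z.im + 2 * d := by positivity
  have ho := relOsc_nonneg u z.re hr
  refine (hu.norm_kernelExt_sub_le hγ hK hr hz hw
    (closedBall_subset_closedBall (by linarith)) (closedBall_subset_closedBall' ?_)).trans ?_
  · rw [Real.dist_eq, abs_sub_comm]
    linarith [abs_re_sub_le z w]
  · have h1 : min 2 (4 * d / z.im) * (z.im + 2 * d) ≤ 8 * d := by
      have h2 : min 2 (4 * d / z.im) * z.im ≤ 4 * d := by
        calc _ ≤ 4 * d / z.im * z.im := by gcongr; exact min_le_right _ _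
          _ = _ := by field_simp
      have h3 : min 2 (4 * d / z.im) * (2 * d) ≤ 2 * (2 * d) := by gcongr; exact min_le_left _ _
      linarith
    have h4 := hu.relOsc_le z.re hr
    set κ := ‖slope c u z.re (z.im + 2 * d)‖
    have h0 : 0 ≤ min 2 (4 * d / z.im) := by positivity
    calc M * min 2 (4 * d / z.im) * (κ * (relOsc u z.re (z.im + 2 * d) * (z.im + 2 * d)))
        ≤ M * min 2 (4 * d / z.im) * (κ * ((9 * e) * (z.im + 2 * d))) := by gcongr
      _ = 9 * (M * e) * κ * (min 2 (4 * d / z.im) * (z.im + 2 * d)) := by ring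
      _ ≤ 9 * (M * e) * κ * (8 * d) := by gcongr
      _ = _ := by ring

lemma IsSmall.locallyLipschitzOn (hu : IsSmall u e) (hγ : IsExpPrimitive c u γ) (hc : c ≠ 0)
    (hK : IsKernel K M) : LocallyLipschitzOn U (kernelExt K γ) := by
  intro z hz
  obtain ⟨C, hC⟩ := (hu.isNearSimilarityOn hγ hc hK hz).exists_lipschitzOnWith
  exact ⟨C, _, mem_nhdsWithin_of_mem_nhds (ball_mem_nhds z (half_pos hz)), hC⟩

lemma IsSmall.relOsc_bound (hu : IsSmall u e) (hK : IsKernel K M) (p : ℝ) {r : ℝ} (hr : 0 < r)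
    {b : ℝ} (hMe : M * e ≤ b) : 16 * M * relOsc u p r ≤ 144 * b := by
  have := mul_le_mul_of_nonneg_left (hu.relOsc_le p hr) hK.nonneg
  linarith

lemma IsSmall.injOn_kernelExt (hu : IsSmall u e) (hγ : IsExpPrimitive c u γ) (hc : c ≠ 0)
    (hK : IsKernel K M) (hMe : M * e ≤ 1 / 576) : InjOn (kernelExt K γ) U := by
  intro z hz w hw h
  wlog hwz : w.im ≤ z.im generalizing z w
  · exact (this hw hz h.symm (le_of_not_ge hwz)).symm
  have h1 := hu.norm_kernelExt_sub_slope_le hγ hK hz (le_of_lt hw) hwz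
  rw [h, sub_self, zero_sub, norm_neg, norm_mul] at h1
  by_contra hne
  have h2 : 0 < ‖slope c u z.re (z.im + 2 * ‖z - w‖)‖ * ‖z - w‖ :=
    mul_pos (norm_pos_iff.2 (slope_ne_zero hc _ _ _)) (norm_pos_iff.2 (sub_ne_zero.2 hne))
  nlinarith

lemma IsSmall.ae_differentiableAt (hu : IsSmall u e) (hγ : IsExpPrimitive c u γ) (hc : c ≠ 0)
    (hK : IsKernel K M) : ∀ᵐ z ∂volume.restrict U, DifferentiableAt ℝ (kernelExt K γ) z :=
  ae_differentiableAt_of_locallyLipschitzOn isOpen_U (hu.locallyLipschitzOn hγ hc hK)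

lemma IsSmall.ae_norm_dzbar_le (hu : IsSmall u e) (hγ : IsExpPrimitive c u γ) (hc : c ≠ 0)
    (hK : IsKernel K M) (hMe : M * e ≤ 1 / 576) : ∀ᵐ z ∂volume.restrict U,
      ‖dzbar (kernelExt K γ) z‖ ≤
        32 * M * relOsc u z.re (2 * z.im) * ‖dz (kernelExt K γ) z‖ ∧
      ‖beltrami (kernelExt K γ) z‖ ≤ 32 * M * relOsc u z.re (2 * z.im) := by
  filter_upwards [hu.ae_differentiableAt hγ hc hK, ae_restrict_mem isOpen_U.measurableSet]
    with z hd hz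
  have hz' : 0 < z.im := hz
  have h := (hu.isNearSimilarityOn hγ hc hK hz).norm_dzbar_le
    ((hu.relOsc_bound hK _ (by positivity) hMe).trans (by norm_num))
    (ball_mem_nhds z (half_pos hz)) hd
  rwa [← mul_assoc, ← mul_assoc, show (2 : ℝ) * 16 = 32 by norm_num] at h

lemma IsSmall.isQuasiconformalOn (hu : IsSmall u e) (hγ : IsExpPrimitive c u γ) (hc : c ≠ 0)
    (hK : IsKernel K M) (hMe : M * e ≤ 1 / 576) : IsQuasiconformalOn (kernelExt K γ) U where
  homeo := by
    have hlip := hu.locallyLipschitzOn hγ hc hK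
    refine IsOpenEmbedding.of_continuous_injective_isOpenMap
      (continuousOn_iff_continuous_domRestrict.1 hlip.continuousOn)
      (injOn_iff_injective.1 (hu.injOn_kernelExt hγ hc hK hMe)) (IsOpenMap.of_nhds_le ?_)
    intro z
    have hz : 0 < (z : ℂ).im := z.2
    have h := (hu.isNearSimilarityOn hγ hc hK hz).map_nhds_eq
      ((hu.relOsc_bound hK _ (by positivity) hMe).trans_lt (by norm_num))
      (ball_mem_nhds (z : ℂ) (half_pos hz))
    change 𝓝 (kernelExt K γ z) ≤ map (kernelExt K γ ∘ Subtype.val) (𝓝 z)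
    rw [← Filter.map_map, isOpen_U.isOpenEmbedding_subtypeVal.map_nhds_eq, h]
  acl := isACL_of_locallyLipschitzOn (hu.locallyLipschitzOn hγ hc hK)
  dilatation := by
    -- Here 32 M `relOsc` ≤ 288 M e ≤ 288/576.
    refine ⟨1 / 2, by norm_num, by norm_num, ?_⟩
    filter_upwards [hu.ae_norm_dzbar_le hγ hc hK hMe, ae_restrict_mem isOpen_U.measurableSet]
      with z hz hzU
    have hz' : 0 < z.im := hzU
    refine hz.1.trans ?_
    gcongr
    have := hu.relOsc_bound hK z.re (r := 2 * z.im) (by positivity) hMe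
    linarith

/-! ### The Weil-Petersson norm of the Beltrami coefficient -/

lemma lintegral_U_eq {F : ℝ × ℝ → ENNReal} (hF : Measurable F) :
    ∫⁻ z in U, F (z.re, z.im) = ∫⁻ y in Ioi (0 : ℝ), ∫⁻ x : ℝ, F (x, y) := by
  have hS : MeasurableSet {p : ℝ × ℝ | 0 < p.2} := measurableSet_lt measurable_const measurable_snd
  have h := Complex.volume_preserving_equiv_real_prod.lintegral_comp
    (f := {p : ℝ × ℝ | 0 < p.2}.indicator F) (hF.indicator hS)
  rw [← lintegral_indicator isOpen_U.measurableSet, ← lintegral_indicator measurableSet_Ioi]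
  calc _ = _ := h
    _ = ∫⁻ p, {p : ℝ × ℝ | 0 < p.2}.indicator F p ∂(volume.prod volume) := rfl
    _ = _ := by
      rw [lintegral_prod_symm _ (hF.indicator hS).aemeasurable]
      refine lintegral_congr fun y => ?_
      by_cases hy : y ∈ Ioi (0 : ℝ)
      · rw [indicator_of_mem hy]
        refine lintegral_congr fun x => ?_
        rw [indicator_of_mem (by exact hy)]
      · rw [indicator_of_notMem hy]
        simp only [indicator_of_notMem (show ((_ : ℝ), y) ∉ {p : ℝ × ℝ | 0 < p.2} from hy),
          lintegral_zero]

lemma lintegral_Ici_inv_cube {a : ℝ} (ha : 0 < a) :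
    ∫⁻ y in Ici a, ENNReal.ofReal (4 / y ^ 3) = ENNReal.ofReal (2 / a ^ 2) := by
  have h1 := integrableOn_Ioi_rpow_of_lt (a := -3) (by norm_num) ha
  have h2 := integral_Ioi_rpow_of_lt (a := -3) (by norm_num) ha
  have h3 : ∀ y ∈ Ioi a, 4 * y ^ (-3 : ℝ) = 4 / y ^ 3 := fun y hy => by
    rw [Real.rpow_neg (ha.trans hy).le, div_eq_mul_inv]; norm_cast
  rw [setLIntegral_congr Ioi_ae_eq_Ici.symm, ← setLIntegral_congr_fun measurableSet_Ioi
    (fun y hy => congrArg ENNReal.ofReal (h3 y hy)), ← ofReal_integral_eq_lintegral_ofReal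
    (h1.const_mul 4), integral_const_mul, h2]
  · congr 1
    have : a ^ (-3 + 1 : ℝ) = (a ^ 2)⁻¹ := by
      rw [← Real.rpow_natCast a 2, ← Real.rpow_neg ha.le]; norm_num
    rw [this]; ring
  · filter_upwards [ae_restrict_mem measurableSet_Ioi] with y hy
    have : 0 < y := ha.trans hy
    positivity

/-- Integrating over x leaves 4/y³ on the region |s - t| ≤ 4y. Integrating over y from |s - t|/4 to
infinity then produces 32/|s - t|², the kernel of the energy. -/
lemma lintegral_U_localEnergy_le (hu : Measurable u) :
    ∫⁻ z in U, ENNReal.ofReal (1 / z.im ^ 4) * localEnergy u z.re (2 * z.im) ≤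
      32 * energy u := by
  have hL := measurable_localEnergy hu
  rw [lintegral_U_eq (F := fun p => ENNReal.ofReal (1 / p.2 ^ 4) * localEnergy u p.1 (2 * p.2))
    ((by fun_prop : Measurable fun p : ℝ × ℝ => ENNReal.ofReal (1 / p.2 ^ 4)).mul
      (hL.comp (by fun_prop : Measurable fun p : ℝ × ℝ => (p.1, 2 * p.2))))]
  let A : Set (ℝ × ℝ × ℝ) := {q | |q.2.1 - q.2.2| ≤ 4 * q.1}
  have hA : MeasurableSet A := (isClosed_le (f := fun q : ℝ × ℝ × ℝ => |q.2.1 - q.2.2|)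
    (g := fun q => 4 * q.1) (by fun_prop) (by fun_prop)).measurableSet
  let G : ℝ × ℝ × ℝ → ENNReal := fun q => ENNReal.ofReal (4 / q.1 ^ 3) *
    A.indicator (fun q => ‖u q.2.1 - u q.2.2‖ₑ ^ 2) q
  have hG : Measurable G := by
    have : Measurable (A.indicator (fun q => ‖u q.2.1 - u q.2.2‖ₑ ^ 2)) :=
      Measurable.indicator (by fun_prop) hA
    fun_prop
  have h1 : ∀ y ∈ Ioi (0 : ℝ), ∫⁻ x : ℝ, ENNReal.ofReal (1 / y ^ 4) * localEnergy u x (2 * y) ≤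
      ∫⁻ s : ℝ, ∫⁻ t : ℝ, G (y, s, t) := by
    intro y hy
    rw [mem_Ioi] at hy
    rw [lintegral_const_mul' _ _ ENNReal.ofReal_ne_top]
    refine (mul_le_mul_right (lintegral_localEnergy_le hu (2 * y)) _).trans ?_
    rw [← mul_assoc, ← ENNReal.ofReal_mul (by positivity),
      ← lintegral_const_mul' _ _ ENNReal.ofReal_ne_top]
    refine lintegral_mono fun s => ?_
    rw [← lintegral_const_mul' _ _ ENNReal.ofReal_ne_top]
    refine lintegral_mono fun t => ?_
    apply le_of_eq
    have e1 : 1 / y ^ 4 * (2 * (2 * y)) = 4 / y ^ 3 := by field_simp; ring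
    have e2 : 2 * (2 * y) = 4 * y := by ring
    rw [e1, e2]
    rfl
  refine (setLIntegral_mono' measurableSet_Ioi h1).trans ?_
  have hsw : ∀ s, ∫⁻ y in Ioi (0 : ℝ), ∫⁻ t, G (y, s, t) = ∫⁻ t, ∫⁻ y in Ioi (0 : ℝ), G (y, s, t) :=
    fun s => lintegral_lintegral_swap (f := fun y t => G (y, s, t))
      (hG.comp (by fun_prop : Measurable fun p : ℝ × ℝ => (p.1, s, p.2))).aemeasurable
  have hG' : Measurable fun q : ℝ × ℝ => ∫⁻ t, G (q.1, q.2, t) :=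
    Measurable.lintegral_prod_right' (f := fun q : (ℝ × ℝ) × ℝ => G (q.1.1, q.1.2, q.2))
      (hG.comp (by fun_prop))
  rw [lintegral_lintegral_swap (f := fun y s => ∫⁻ t, G (y, s, t)) hG'.aemeasurable]
  simp only [hsw]
  unfold energy
  rw [show (32 : ENNReal) = ENNReal.ofReal 32 by simp,
    ← lintegral_const_mul' _ _ ENNReal.ofReal_ne_top]
  refine lintegral_mono fun s => ?_
  rw [← lintegral_const_mul' _ _ ENNReal.ofReal_ne_top]
  refine lintegral_mono fun t => ?_
  rcases eq_or_ne s t with rfl | hst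
  · have : ∀ y, G (y, s, s) = 0 := fun y => by
      simp only [G, indicator_apply]; simp
    simp [this]
  · have ha : 0 < |s - t| / 4 := by
      have := abs_pos.2 (sub_ne_zero.2 hst); positivity
    have h2 : ∀ y, G (y, s, t) = (Ici (|s - t| / 4)).indicator
        (fun y => ENNReal.ofReal (4 / y ^ 3) * ‖u s - u t‖ₑ ^ 2) y := by
      intro y
      by_cases hy : y ∈ Ici (|s - t| / 4)
      · have : (y, s, t) ∈ A := by
          rw [mem_Ici] at hy
          change |s - t| ≤ 4 * y
          linarith
        simp only [G, indicator_of_mem hy, indicator_of_mem this]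
      · have : (y, s, t) ∉ A := by
          intro h
          apply hy
          change |s - t| ≤ 4 * y at h
          rw [mem_Ici]; linarith
        simp only [G, indicator_of_notMem hy, indicator_of_notMem this, mul_zero]
    simp only [h2]
    refine (setLIntegral_le_lintegral _ _).trans ?_
    rw [lintegral_indicator measurableSet_Ici, lintegral_mul_const' _ _ (by simp),
      lintegral_Ici_inv_cube ha, ← ofReal_norm, ← ENNReal.ofReal_pow (norm_nonneg _),
      ← ENNReal.ofReal_mul (by positivity), ← ENNReal.ofReal_mul (by positivity)]
    apply ENNReal.ofReal_le_ofReal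
    apply le_of_eq
    field_simp
    ring

lemma IsSmall.wpNorm_beltrami_le (hu : IsSmall u e) (hγ : IsExpPrimitive c u γ) (hc : c ≠ 0)
    (hK : IsKernel K M) (hMe : M * e ≤ 1 / 576) :
    eLpNorm (beltrami (kernelExt K γ)) ⊤ (volume.restrict U) ≤ ENNReal.ofReal (288 * M * e) ∧
    wpNorm (beltrami (kernelExt K γ)) ≤ ENNReal.ofReal (1000 * M * e) := by
  have hM := hK.nonneg
  have he := hu.nonneg
  have hb := hu.ae_norm_dzbar_le hγ hc hK hMe
  have hU := ae_restrict_mem (μ := volume) isOpen_U.measurableSet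
  have h1 : eLpNorm (beltrami (kernelExt K γ)) ⊤ (volume.restrict U) ≤
      ENNReal.ofReal (288 * M * e) := by
    rw [eLpNorm_exponent_top]
    refine eLpNormEssSup_le_of_ae_bound ?_
    filter_upwards [hb, hU] with z hz hzU
    have hz' : 0 < z.im := hzU
    have := mul_le_mul_of_nonneg_left (hu.relOsc_le z.re (r := 2 * z.im) (by positivity)) hM
    linarith [hz.2]
  refine ⟨h1, ?_⟩
  have h2 : ∫⁻ z in U, ENNReal.ofReal (‖beltrami (kernelExt K γ) z‖ ^ 2 / z.im ^ 2) ≤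
      ENNReal.ofReal ((700 * M * e) ^ 2) := by
    have h3 : ∀ᵐ z ∂volume.restrict U,
        ENNReal.ofReal (‖beltrami (kernelExt K γ) z‖ ^ 2 / z.im ^ 2) ≤
          ENNReal.ofReal (5120 * M ^ 2) *
            (ENNReal.ofReal (1 / z.im ^ 4) * localEnergy u z.re (2 * z.im)) := by
      filter_upwards [hb, hU] with z hz hzU
      have hz' : 0 < z.im := hzU
      have h4 := hu.ofReal_relOsc_sq_le z.re (r := 2 * z.im) (by positivity)
      calc _ ≤ ENNReal.ofReal ((32 * M * relOsc u z.re (2 * z.im)) ^ 2 / z.im ^ 2) := by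
            gcongr; exact hz.2
        _ = ENNReal.ofReal (1024 * M ^ 2 / z.im ^ 2) *
            ENNReal.ofReal (relOsc u z.re (2 * z.im) ^ 2) := by
          rw [← ENNReal.ofReal_mul (by positivity)]; congr 1; ring
        _ ≤ ENNReal.ofReal (1024 * M ^ 2 / z.im ^ 2) *
            (ENNReal.ofReal (20 / (2 * z.im) ^ 2) * localEnergy u z.re (2 * z.im)) := by gcongr
        _ = _ := by
          rw [← mul_assoc, ← mul_assoc, ← ENNReal.ofReal_mul (by positivity),
            ← ENNReal.ofReal_mul (by positivity)]
          congr 2; field_simp; ring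
    refine (lintegral_mono_ae h3).trans ?_
    rw [lintegral_const_mul' _ _ ENNReal.ofReal_ne_top]
    refine (mul_le_mul_right ((lintegral_U_localEnergy_le hu.measurable).trans
      (mul_le_mul_right hu.energy_le _)) _).trans ?_
    rw [show (32 : ENNReal) = ENNReal.ofReal 32 by simp, ← ENNReal.ofReal_mul (by positivity),
      ← ENNReal.ofReal_mul (by positivity)]
    apply ENNReal.ofReal_le_ofReal
    -- The comparison is 5120 · 32 ≤ 700².
    nlinarith [sq_nonneg (M * e)]
  have h5 : (ENNReal.ofReal (1 / Real.pi) *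
      ∫⁻ z in U, ENNReal.ofReal (‖beltrami (kernelExt K γ) z‖ ^ 2 / z.im ^ 2)) ^ (1 / 2 : ℝ) ≤
      ENNReal.ofReal (700 * M * e) := by
    have h6 : ENNReal.ofReal (1 / Real.pi) ≤ 1 := by
      rw [ENNReal.ofReal_le_one, div_le_one Real.pi_pos]
      linarith [Real.pi_gt_three]
    calc _ ≤ (1 * ENNReal.ofReal ((700 * M * e) ^ 2)) ^ (1 / 2 : ℝ) := by gcongr
      _ = _ := by
        rw [one_mul, ENNReal.ofReal_rpow_of_nonneg (by positivity) (by norm_num),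
          ← Real.sqrt_eq_rpow, Real.sqrt_sq (by positivity)]
  rw [wpNorm]
  refine (add_le_add h1 h5).trans ?_
  rw [← ENNReal.ofReal_add (by positivity) (by positivity)]
  apply ENNReal.ofReal_le_ofReal
  nlinarith [mul_nonneg hM he]

lemma IsSmall.beltrami_mem_classM (hu : IsSmall u e) (hγ : IsExpPrimitive c u γ) (hc : c ≠ 0)
    (hK : IsKernel K M) (hMe : M * e ≤ 1 / 576) : beltrami (kernelExt K γ) ∈ classM := by
  have hm := aestronglyMeasurable_beltrami (hu.ae_differentiableAt hγ hc hK)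
  obtain ⟨h1, h2⟩ := hu.wpNorm_beltrami_le hγ hc hK hMe
  refine ⟨⟨hm, h1.trans_lt ?_⟩, hm, h2.trans_lt ENNReal.ofReal_lt_top⟩
  rw [ENNReal.ofReal_lt_one]
  linarith

/-! ### Functions of small `H^{1/2}` seminorm -/

lemma energy_eq_halfNorm (u : ℝ → ℂ) :
    energy u = ENNReal.ofReal (4 * Real.pi ^ 2) * halfNorm u ^ 2 := by
  have hπ := Real.pi_pos
  have h : halfNorm u = (ENNReal.ofReal (1 / (4 * Real.pi ^ 2)) * energy u) ^ (1 / 2 : ℝ) := rfl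
  rw [h, ← ENNReal.rpow_natCast, ← ENNReal.rpow_mul]
  norm_num only [Nat.cast_ofNat, ENNReal.rpow_one]
  rw [← mul_assoc, ← ENNReal.ofReal_mul (by positivity),
    mul_one_div_cancel (by positivity), ENNReal.ofReal_one, one_mul]

lemma energy_congr {u v : ℝ → ℂ} (h : u =ᵐ[volume] v) : energy u = energy v := by
  refine lintegral_congr_ae ?_
  filter_upwards [h] with x hx
  refine lintegral_congr_ae ?_
  filter_upwards [h] with t ht
  rw [hx, ht]

lemma isSmall_of_ae_eq {u v : ℝ → ℂ} {δ : ℝ} (hu : MemHalf u) (hδ : halfNorm u < ENNReal.ofReal δ)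
    (hδ' : 2 * Real.pi * δ ≤ 1 / 40) (hv : Measurable v) (h : u =ᵐ[volume] v) :
    IsSmall v (2 * Real.pi * (halfNorm u).toReal) where
  measurable := hv
  locallyIntegrable := hu.1.congr h
  nonneg := by positivity
  le := by
    refine le_trans ?_ hδ'
    gcongr
    exact (ENNReal.toReal_lt_of_lt_ofReal hδ).le
  energy_le := by
    rw [← energy_congr h, energy_eq_halfNorm]
    conv_lhs => rw [← ENNReal.ofReal_toReal hu.2.ne]
    rw [← ENNReal.ofReal_pow (by positivity), ← ENNReal.ofReal_mul (by positivity)]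
    apply ENNReal.ofReal_le_ofReal
    apply le_of_eq; ring

/-- If the integral vanished, e^(u-a) - 1 would have integral -1 over [0, 1], where a is the mean of
u there; but its absolute value has integral at most 9e/2 < 1. -/
lemma IsSmall.integral_exp_ne_zero (hu : IsSmall u e) :
    (∫ t in (0 : ℝ)..1, Complex.exp (u t)) ≠ 0 := by
  have hγ : IsExpPrimitive 1 u fun t => ∫ x in (0 : ℝ)..t, Complex.exp (u x) := by
    intro s t
    have hi : ∀ a b, IntervalIntegrable (fun t => Complex.exp (u t)) volume a b := fun a b =>
      (hu.locallyIntegrable_exp.integrableOn_isCompact isCompact_uIcc).intervalIntegrable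
    rw [one_mul, intervalIntegral.integral_interval_sub_left (hi _ _) (hi _ _)]
  have h := hu.primitive_sub_eq hγ (1 / 2) (1 / 2) 0 1
  intro h0
  simp only [h0, intervalIntegral.integral_same, Complex.ofReal_one, Complex.ofReal_zero, sub_zero,
    zero_sub, mul_one, intervalIntegral.integral_const_mul] at h
  have hne := slope_ne_zero one_ne_zero u (1 / 2) (1 / 2)
  have h1 : ‖∫ x in (0 : ℝ)..1, (Complex.exp (u x - mean u (1 / 2) (1 / 2)) - 1)‖ₑ = 1 := by
    have : (∫ x in (0 : ℝ)..1, (Complex.exp (u x - mean u (1 / 2) (1 / 2)) - 1)) = -1 := by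
      apply mul_left_cancel₀ hne
      rw [← h]; ring
    rw [this]; simp
  have h2 : ‖∫ x in (0 : ℝ)..1, (Complex.exp (u x - mean u (1 / 2) (1 / 2)) - 1)‖ₑ ≤
      ENNReal.ofReal (9 * e * (1 / 2)) := by
    rw [intervalIntegral.integral_of_le zero_le_one]
    refine (enorm_integral_le_lintegral_enorm _).trans
      (le_trans (lintegral_mono_set ?_) (hu.expOsc_le (p := 1 / 2) (by norm_num)))
    rw [Real.closedBall_eq_Icc]
    norm_num
    exact Ioc_subset_Icc_self
  rw [h1, ENNReal.one_le_ofReal] at h2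
  linarith [hu.le]

/-! ### Dependence on the values in the half plane only -/

lemma dz_congr {f g : ℂ → ℂ} {z : ℂ} (h : f =ᶠ[𝓝 z] g) :
    dz f z = dz g z ∧ dzbar f z = dzbar g z := by
  simp only [dz, dzbar, h.lineDeriv_eq, and_self]

lemma dz_eq_of_eqOn {f g : ℂ → ℂ} (h : EqOn f g U) {z : ℂ} (hz : z ∈ U) :
    dz f z = dz g z ∧ dzbar f z = dzbar g z :=
  dz_congr (h.eventuallyEq_of_mem (isOpen_U.mem_nhds hz))

lemma absolutelyContinuousOnInterval_congr {f g : ℝ → ℂ} {a b : ℝ} (h : EqOn f g (uIcc a b))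
    (hf : AbsolutelyContinuousOnInterval f a b) : AbsolutelyContinuousOnInterval g a b := by
  rw [absolutelyContinuousOnInterval_iff] at hf ⊢
  intro ε hε
  obtain ⟨δ, hδ, H⟩ := hf ε hε
  refine ⟨δ, hδ, fun E hE hl => ?_⟩
  refine lt_of_eq_of_lt (Finset.sum_congr rfl fun i hi => ?_) (H E hE hl)
  rw [h (hE.1 i hi).1, h (hE.1 i hi).2]

lemma IsQuasiconformalOn.congr {f g : ℂ → ℂ} (hf : IsQuasiconformalOn f U) (h : EqOn f g U) :
    IsQuasiconformalOn g U where
  homeo := by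
    have : U.domRestrict g = U.domRestrict f := by
      ext z; exact (h z.2).symm
    rw [this]; exact hf.homeo
  acl := by
    intro a b c d hab hcd hR
    refine ⟨?_, ?_⟩
    · filter_upwards [(hf.acl a b c d hab hcd hR).1] with y hy hyI
      refine absolutelyContinuousOnInterval_congr (fun x hx => h (hR ?_)) (hy hyI)
      rw [uIcc_of_le hab.le] at hx
      exact ⟨hx, hyI⟩
    · filter_upwards [(hf.acl a b c d hab hcd hR).2] with x hx hxI
      refine absolutelyContinuousOnInterval_congr (fun y hy => h (hR ?_)) (hx hxI)
      rw [uIcc_of_le hcd.le] at hy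
      exact ⟨hxI, hy⟩
  dilatation := by
    obtain ⟨k, hk0, hk1, hk⟩ := hf.dilatation
    refine ⟨k, hk0, hk1, ?_⟩
    filter_upwards [hk, ae_restrict_mem isOpen_U.measurableSet] with z hz hzU
    rwa [← (dz_eq_of_eqOn h hzU).1, ← (dz_eq_of_eqOn h hzU).2]

lemma beltrami_ae_eq {f g : ℂ → ℂ} (h : EqOn f g U) :
    beltrami f =ᵐ[volume.restrict U] beltrami g := by
  filter_upwards [ae_restrict_mem isOpen_U.measurableSet] with z hz
  simp only [beltrami, dz_eq_of_eqOn h hz]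

lemma wpNorm_congr {μ ν : ℂ → ℂ} (h : μ =ᵐ[volume.restrict U] ν) : wpNorm μ = wpNorm ν := by
  unfold wpNorm
  rw [eLpNorm_congr_ae h]
  congr 3
  refine lintegral_congr_ae ?_
  filter_upwards [h] with z hz
  rw [hz]

lemma mem_classM_congr {μ ν : ℂ → ℂ} (h : μ =ᵐ[volume.restrict U] ν) (hμ : μ ∈ classM) :
    ν ∈ classM :=
  ⟨⟨hμ.1.1.congr h, eLpNorm_congr_ae h ▸ hμ.1.2⟩, hμ.2.1.congr h, wpNorm_congr h ▸ hμ.2.2⟩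

/-- Semmes' map for a function of small seminorm. -/
lemma rhoMap_properties {φ ψ : ℝ → ℝ} (hφψ : IsSemmesPair φ ψ) (hK : IsKernel (semmesKernel φ ψ) M)
    {δ : ℝ} (hδ : 2 * Real.pi * δ ≤ 1 / 40) (hδ' : M * (2 * Real.pi * δ) ≤ 1 / 576)
    {u : ℝ → ℂ} (hu : MemHalf u) (hu' : halfNorm u < ENNReal.ofReal δ) :
    LocallyIntegrable (fun t => Complex.exp (u t)) volume ∧
      (∫ t in (0 : ℝ)..1, Complex.exp (u t)) ≠ 0 ∧
      IsQuasiconformalOn (rhoMap φ ψ u) U ∧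
      wpNorm (beltrami (rhoMap φ ψ u)) ≤ Real.toNNReal (1000 * M * (2 * Real.pi)) * halfNorm u ∧
      beltrami (rhoMap φ ψ u) ∈ classM := by
  -- The estimates require a measurable function. Passing to a representative v changes neither the
  -- energy nor any integral of the exponential, so `gammaMap u` is also a primitive for v.
  obtain ⟨v, hvm, huv⟩ := hu.1.aestronglyMeasurable
  have hv := isSmall_of_ae_eq hu hu' hδ hvm.measurable huv
  have hM := hK.nonneg
  have hMe : M * (2 * Real.pi * (halfNorm u).toReal) ≤ 1 / 576 := by
    refine le_trans ?_ hδ'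
    gcongr
    exact (ENNReal.toReal_lt_of_lt_ofReal hu').le
  have hexp : (fun t => Complex.exp (v t)) =ᵐ[volume] fun t => Complex.exp (u t) := by
    filter_upwards [huv] with t ht
    rw [ht]
  have hint : ∀ a b : ℝ, (∫ t in a..b, Complex.exp (v t)) = ∫ t in a..b, Complex.exp (u t) :=
    fun a b => intervalIntegral.integral_congr_ae (hexp.mono fun t ht _ => ht)
  have hne := hv.integral_exp_ne_zero
  rw [hint] at hne
  have hγ : IsExpPrimitive (∫ t in (0 : ℝ)..1, Complex.exp (u t))⁻¹ v (gammaMap u) := by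
    intro s t
    have hi : ∀ a b, IntervalIntegrable (fun t => Complex.exp (v t)) volume a b := fun a b =>
      (hv.locallyIntegrable_exp.integrableOn_isCompact isCompact_uIcc).intervalIntegrable
    rw [gammaMap, gammaMap, ← sub_div, ← hint 0 t, ← hint 0 s,
      intervalIntegral.integral_interval_sub_left (hi _ _) (hi _ _), div_eq_inv_mul]
  -- The two formulas are matched only for y > 0; all the properties concerned depend only on values
  -- in the open half plane.
  have hEq : EqOn (kernelExt (semmesKernel φ ψ) (gammaMap u)) (rhoMap φ ψ u) U := fun z hz =>
    (convScale_sub_eq_kernelExt hφψ (hv.continuous hγ) hz).symm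
  have hc := inv_ne_zero hne
  have hb := beltrami_ae_eq hEq
  refine ⟨hv.locallyIntegrable_exp.congr hexp, hne,
    (hv.isQuasiconformalOn hγ hc hK hMe).congr hEq, ?_,
    mem_classM_congr hb (hv.beltrami_mem_classM hγ hc hK hMe)⟩
  rw [← wpNorm_congr hb]
  refine (hv.wpNorm_beltrami_le hγ hc hK hMe).2.trans (le_of_eq ?_)
  conv_rhs => rw [← ENNReal.ofReal_toReal hu.2.ne]
  rw [← mul_assoc, ENNReal.ofReal_mul (by positivity)]
  rfl

/-! ### Real primitives and quasi-isometry -/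

lemma continuous_kernelExt (hK : IsKernel K M) (hγ : Continuous γ) :
    Continuous (kernelExt K γ) := by
  have h : kernelExt K γ = fun z => ∫ s in Icc (-1 : ℝ) 1, K s * γ (z.re - z.im * s) := by
    ext z
    rw [kernelExt, setIntegral_eq_integral_of_forall_compl_eq_zero]
    intro s hs
    rw [hK.support s hs, zero_mul]
  rw [h]
  have := hK.continuous
  exact continuous_parametric_integral_of_continuous (by fun_prop) isCompact_Icc

/-- Doubling the small radius costs 2e per step, and the final comparison at comparable radii costs
3e. The slope e^a thus varies at most like a small power of the ratio of scales. -/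
lemma IsSmall.norm_mean_sub_mean_le_of_le_two_pow (hu : IsSmall u e) {p R : ℝ} (n : ℕ) :
    ∀ {x r : ℝ}, 0 < r → r ≤ R → |x - p| ≤ R → R ≤ 2 ^ n * r →
      ‖mean u x r - mean u p R‖ ≤ (2 * n + 3) * e := by
  have he := hu.nonneg
  have key : ∀ {x r : ℝ}, 0 < r → r ≤ R → |x - p| ≤ R → R ≤ 2 * r →
      ‖mean u x r - mean u p R‖ ≤ 3 * e := by
    intro x r hr hrR hx h
    refine norm_mean_sub_mean_le hu.locallyIntegrable he (by norm_num) hu.energy_le hr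
      (by linarith) (p := p) (R := 2 * R) (closedBall_subset_closedBall' ?_)
      (closedBall_subset_closedBall (by linarith)) (by nlinarith)
    rw [Real.dist_eq]; linarith
  induction n with
  | zero =>
    intro x r hr hrR hx h
    simpa using key hr hrR hx (by linarith)
  | succ n ih =>
    intro x r hr hrR hx h
    by_cases h2 : 2 * r ≤ R
    · have h3 := ih (x := x) (r := 2 * r) (by positivity) h2 hx (by rw [pow_succ] at h; linarith)
      have h4 : ‖mean u x r - mean u x (2 * r)‖ ≤ 2 * e :=
        norm_mean_sub_mean_le hu.locallyIntegrable he (by norm_num) hu.energy_le hr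
          (by positivity) (p := x) (R := 2 * r) (closedBall_subset_closedBall (by linarith))
          subset_rfl (by nlinarith)
      have h5 := norm_sub_le_norm_sub_add_norm_sub (mean u x r) (mean u x (2 * r)) (mean u p R)
      push_cast
      linarith
    · have := key hr hrR hx (by linarith)
      have h6 : 0 ≤ (n : ℝ) * e := by positivity
      push_cast
      linarith

lemma slope_one_ofReal (f : ℝ → ℝ) (p r : ℝ) :
    slope 1 (fun x => (f x : ℂ)) p r =
      ((Real.exp (mean (fun x => (f x : ℂ)) p r).re : ℝ) : ℂ) := by
  have h : mean (fun x => (f x : ℂ)) p r = ((⨍ t in closedBall p r, f t : ℝ) : ℂ) := by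
    rw [mean, setAverage_eq, setAverage_eq, integral_complex_ofReal]
    simp
  rw [slope, one_mul, h, Complex.ofReal_re, Complex.ofReal_exp]

/-- The logarithm of the reference slope of a real primitive. -/
def logSlope (f : ℝ → ℝ) (p r : ℝ) : ℝ := (mean (fun x => (f x : ℂ)) p r).re

/-- The comparison of z with its projection x = Re z to the line. The boundary value h(x) and the
slope are real, so taking imaginary parts isolates slope times height; 72 M e ≤ 1/8. -/
lemma im_kernelExt_bounds (hf : IsSmall (fun x => (f x : ℂ)) e)
    (hh : IsExpPrimitive 1 (fun x => (f x : ℂ)) fun x => (h x : ℂ)) (hK : IsKernel K M)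
    (hMe : M * e ≤ 1 / 576) {z : ℂ} (hz : 0 < z.im) :
    7 / 8 * (Real.exp (logSlope f z.re (3 * z.im)) * z.im) ≤
        (kernelExt K (fun x => (h x : ℂ)) z).im ∧
      (kernelExt K (fun x => (h x : ℂ)) z).im ≤
        9 / 8 * (Real.exp (logSlope f z.re (3 * z.im)) * z.im) := by
  have h1 := hf.norm_kernelExt_sub_slope_le hh hK (w := (z.re : ℂ)) hz (by simp)
    (by simpa using hz.le)
  have e1 : z - z.re = z.im * Complex.I := by
    apply Complex.ext <;> simp
  have e2 : ‖z - z.re‖ = z.im := by rw [e1]; simp [abs_of_pos hz]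
  rw [e2, show z.im + 2 * z.im = 3 * z.im by ring, slope_one_ofReal, hK.kernelExt_ofReal,
    Complex.norm_real, Real.norm_of_nonneg (Real.exp_pos _).le, e1] at h1
  change _ ≤ 72 * (M * e) * (Real.exp (logSlope f z.re (3 * z.im)) * z.im) at h1
  have h2 := (Complex.abs_im_le_norm _).trans h1
  have e3 : (kernelExt K (fun x => (h x : ℂ)) z - (h z.re : ℂ) -
      ((Real.exp (mean (fun x => (f x : ℂ)) z.re (3 * z.im)).re : ℝ) : ℂ) * (z.im * Complex.I)).im =
      (kernelExt K (fun x => (h x : ℂ)) z).im -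
        Real.exp (logSlope f z.re (3 * z.im)) * z.im := by
    simp [logSlope, Complex.mul_im, -Complex.ofReal_exp]
  rw [e3] at h2
  set k := Real.exp (logSlope f z.re (3 * z.im)) * z.im
  have hk : 0 < k := mul_pos (Real.exp_pos _) hz
  have h3 : 72 * (M * e) * k ≤ 1 / 8 * k := by gcongr; linarith
  have h4 := abs_le.1 (h2.trans h3)
  constructor <;> linarith [h4.1, h4.2]

lemma norm_kernelExt_sub_bounds (hf : IsSmall (fun x => (f x : ℂ)) e)
    (hh : IsExpPrimitive 1 (fun x => (f x : ℂ)) fun x => (h x : ℂ)) (hK : IsKernel K M)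
    (hMe : M * e ≤ 1 / 576) {z w : ℂ} (hz : 0 < z.im)
    (hw : 0 ≤ w.im) (hwz : w.im ≤ z.im) :
    7 / 8 * (Real.exp (logSlope f z.re (z.im + 2 * ‖z - w‖)) * ‖z - w‖) ≤
        ‖kernelExt K (fun x => (h x : ℂ)) z - kernelExt K (fun x => (h x : ℂ)) w‖ ∧
      ‖kernelExt K (fun x => (h x : ℂ)) z - kernelExt K (fun x => (h x : ℂ)) w‖ ≤
        9 / 8 * (Real.exp (logSlope f z.re (z.im + 2 * ‖z - w‖)) * ‖z - w‖) := by
  have h1 := hf.norm_kernelExt_sub_slope_le hh hK hz hw hwz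
  set d := ‖z - w‖ with hd
  set W := kernelExt K (fun x => (h x : ℂ)) z - kernelExt K (fun x => (h x : ℂ)) w
  have e1 : ‖slope 1 (fun x => (f x : ℂ)) z.re (z.im + 2 * d)‖ =
      Real.exp (logSlope f z.re (z.im + 2 * d)) := by
    rw [slope_one_ofReal, Complex.norm_real, Real.norm_of_nonneg (Real.exp_pos _).le]; rfl
  have e2 : ‖slope 1 (fun x => (f x : ℂ)) z.re (z.im + 2 * d) * (z - w)‖ =
      Real.exp (logSlope f z.re (z.im + 2 * d)) * d := by rw [norm_mul, e1]
  rw [e1] at h1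
  have h2 := norm_sub_norm_le W (slope 1 (fun x => (f x : ℂ)) z.re (z.im + 2 * d) * (z - w))
  have h3 := norm_sub_norm_le (slope 1 (fun x => (f x : ℂ)) z.re (z.im + 2 * d) * (z - w)) W
  rw [norm_sub_rev _ W] at h3
  rw [e2] at h2 h3
  set k := Real.exp (logSlope f z.re (z.im + 2 * d)) * d
  have hk : 0 ≤ k := mul_nonneg (Real.exp_pos _).le (norm_nonneg _)
  have h4 : 72 * (M * e) * k ≤ 1 / 8 * k := by gcongr; linarith
  constructor <;> linarith

/-- Comparison of the slopes that belong to two points and to the pair of them. -/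
lemma exp_logSlope_sub_le (hf : IsSmall (fun x => (f x : ℂ)) e)
    (he : e ≤ 1 / 400) {z w : ℂ} (hz : 0 < z.im) (hw : 0 < w.im)
    (hwz : w.im ≤ z.im) :
    Real.exp |2 * logSlope f z.re (z.im + 2 * ‖z - w‖) - logSlope f z.re (3 * z.im) -
      logSlope f w.re (3 * w.im)| ^ 2 ≤ 2 * ((z.im + ‖z - w‖) / w.im) := by
  set d := ‖z - w‖ with hd
  have hd0 : 0 ≤ d := norm_nonneg _
  have he0 := hf.nonneg
  have hR : 1 ≤ (z.im + d) / w.im := by rw [one_le_div hw]; linarith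
  -- The integer n counts the dyadic scales from Im w up to Im z + d. All three slopes are compared
  -- with the one at scale 3(Im z + d).
  obtain ⟨n, hn1, hn2⟩ := exists_nat_pow_near hR one_lt_two
  have hn3 : z.im + d ≤ 2 ^ (n + 1) * w.im := by
    rw [div_lt_iff₀ hw] at hn2; exact hn2.le
  have hp : (0 : ℝ) < 2 ^ n := by positivity
  have h8 : (2 : ℝ) ^ (n + 3) = 8 * 2 ^ n := by rw [pow_add]; ring
  have h2 : (2 : ℝ) ^ (n + 1) = 2 * 2 ^ n := by rw [pow_add]; ring
  have h1n : (1 : ℝ) ≤ 2 ^ n := one_le_pow₀ (by norm_num)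
  have key : ∀ {x r : ℝ}, 0 < r → r ≤ 3 * (z.im + d) → |x - z.re| ≤ 3 * (z.im + d) →
      3 * (z.im + d) ≤ 2 ^ (n + 3) * r →
      |logSlope f x r - logSlope f z.re (3 * (z.im + d))| ≤ (2 * n + 9) * e := by
    intro x r hr hr' hx hR'
    have h3 := hf.norm_mean_sub_mean_le_of_le_two_pow (n + 3) hr hr' hx hR'
    have h4 := (abs_re_sub_le _ _).trans h3
    push_cast at h4
    refine h4.trans (le_of_eq ?_)
    ring
  have k1 := key (x := z.re) (r := z.im + 2 * d) (by positivity) (by linarith)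
    (by simp; positivity) (by rw [h8]; nlinarith)
  have k2 := key (x := z.re) (r := 3 * z.im) (by positivity) (by linarith)
    (by simp; positivity) (by rw [h8]; rw [h2] at hn3; nlinarith)
  have k3 := key (x := w.re) (r := 3 * w.im) (by positivity) (by linarith)
    (by rw [abs_sub_comm]; linarith [abs_re_sub_le z w]) (by rw [h8]; rw [h2] at hn3; nlinarith)
  have k4 : |2 * logSlope f z.re (z.im + 2 * d) - logSlope f z.re (3 * z.im) -
      logSlope f w.re (3 * w.im)| ≤ 4 * ((2 * n + 9) * e) := by
    rw [abs_le] at k1 k2 k3 ⊢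
    constructor <;> linarith [k1.1, k1.2, k2.1, k2.2, k3.1, k3.2]
  -- The bound e ≤ 1/400 is used here: the total logarithmic error stays below log 2 per dyadic
  -- scale.
  have k5 : 2 * (4 * ((2 * n + 9) * e)) ≤ Real.log 2 * (n + 1 : ℕ) := by
    have hl := Real.log_two_gt_d9
    have hn0 : (0 : ℝ) ≤ n := n.cast_nonneg
    have : (2 * (n : ℝ) + 9) * e ≤ (2 * n + 9) * (1 / 400) := by gcongr
    push_cast
    nlinarith
  calc _ = Real.exp (2 * |2 * logSlope f z.re (z.im + 2 * d) - logSlope f z.re (3 * z.im) -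
      logSlope f w.re (3 * w.im)|) := by rw [← Real.exp_nat_mul]; norm_num
    _ ≤ Real.exp (Real.log 2 * (n + 1 : ℕ)) := Real.exp_le_exp.2 (by linarith)
    _ = 2 ^ (n + 1) := by
      rw [← Real.rpow_def_of_pos (by norm_num), Real.rpow_natCast]
    _ ≤ _ := by rw [h2]; linarith

/-! ### Hyperbolic sine and hyperbolic distance -/

lemma sinh_two_mul_ge {a : ℝ} (ha : 0 ≤ a) :
    Real.sinh a + Real.sinh a ^ 2 ≤ Real.sinh (2 * a) := by
  have h0 := Real.sinh_nonneg_iff.2 ha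
  have h1 := Real.one_le_cosh a
  have h2 := Real.cosh_sq a
  have h3 : Real.sinh a ≤ Real.cosh a := by
    nlinarith [Real.cosh_pos a]
  rw [Real.sinh_two_mul]
  nlinarith

lemma sinh_three_mul_ge {a : ℝ} (ha : 0 ≤ a) : 3 * Real.sinh a ≤ Real.sinh (3 * a) := by
  have h0 := Real.sinh_nonneg_iff.2 ha
  rw [Real.sinh_three_mul]
  have : 0 ≤ Real.sinh a ^ 3 := by positivity
  linarith

/-- The number k² + k exceeds the positive root of q² = k²(1 + q). -/
lemma le_of_sq_le_one_add_mul {q k : ℝ} (hk : 0 ≤ k) (h : q ^ 2 ≤ k ^ 2 * (1 + q)) :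
    q ≤ k ^ 2 + k := by
  by_contra! hlt
  have h0 : 0 ≤ k ^ 2 + k := by positivity
  have h1 : 0 < q - k ^ 2 - k := by linarith
  nlinarith [mul_pos h1 h1, mul_nonneg h0 h1.le, pow_nonneg hk 3]

lemma le_mul_of_sq_sinh_le {a b : ℝ} (ha : 0 ≤ a)
    (h : Real.sinh b ^ 2 ≤ 9 * (1 + Real.sinh a) * Real.sinh a ^ 2) : b ≤ 6 * a := by
  have h0 := Real.sinh_nonneg_iff.2 ha
  have h1 : Real.sinh b ≤ 3 * (Real.sinh a + Real.sinh a ^ 2) := by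
    apply le_of_sq_le_sq _ (by positivity)
    refine h.trans ?_
    have : 0 ≤ Real.sinh a ^ 3 := by positivity
    have : 0 ≤ Real.sinh a ^ 4 := by positivity
    nlinarith
  have h2 := sinh_three_mul_ge (a := 2 * a) (by positivity)
  have h3 : Real.sinh b ≤ Real.sinh (3 * (2 * a)) := by
    linarith [sinh_two_mul_ge ha]
  linarith [Real.sinh_le_sinh.1 h3]

/-- The quadratic inequality gives sinh b ≤ 9(sinh a + sinh² a) ≤ 9 sinh 2a ≤ sinh 18a. -/
lemma le_mul_of_sq_le_sinh {a b : ℝ} (ha : 0 ≤ a)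
    (h : Real.sinh b ^ 2 ≤ 9 * (1 + Real.sinh b) * Real.sinh a ^ 2) : b ≤ 18 * a := by
  have h0 := Real.sinh_nonneg_iff.2 ha
  have h1 := le_of_sq_le_one_add_mul (k := 3 * Real.sinh a) (q := Real.sinh b) (by positivity)
    (by linarith)
  have h2 := sinh_three_mul_ge (a := 2 * a) (by positivity)
  have h3 := sinh_three_mul_ge (a := 3 * (2 * a)) (by positivity)
  have h4 : Real.sinh b ≤ Real.sinh (3 * (3 * (2 * a))) := by
    nlinarith [sinh_two_mul_ge ha]
  linarith [Real.sinh_le_sinh.1 h4]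

lemma sq_sinh_half_dist (z w : UpperHalfPlane) :
    Real.sinh (dist z w / 2) ^ 2 = ‖(z : ℂ) - w‖ ^ 2 / (4 * (z.im * w.im)) := by
  rw [UpperHalfPlane.sinh_half_dist, div_pow, mul_pow, 
    Real.sq_sqrt (mul_pos z.im_pos w.im_pos).le, dist_eq_norm]
  norm_num

/-- A map of the half plane that is comparable to similarities on pairs of points, with factors
varying slowly in the hyperbolic distance, is bi-Lipschitz. -/
lemma dist_le_of_comparable {z w z' w' : UpperHalfPlane} {k k₁ k₂ : ℝ}
    (hk : 0 < k) (hk₁ : 0 < k₁) (hk₂ : 0 < k₂)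
    (hz : 7 / 8 * (k₁ * z.im) ≤ z'.im ∧ z'.im ≤ 9 / 8 * (k₁ * z.im))
    (hw : 7 / 8 * (k₂ * w.im) ≤ w'.im ∧ w'.im ≤ 9 / 8 * (k₂ * w.im))
    (hd : 7 / 8 * (k * ‖(z : ℂ) - w‖) ≤ ‖(z' : ℂ) - w'‖ ∧
      ‖(z' : ℂ) - w'‖ ≤ 9 / 8 * (k * ‖(z : ℂ) - w‖))
    {E : ℝ} (hE : 0 < E) (h1 : k ^ 2 ≤ E * (k₁ * k₂)) (h2 : k₁ * k₂ ≤ E * k ^ 2)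
    (hE' : E ^ 2 ≤ 2 * ((z.im + ‖(z : ℂ) - w‖) / w.im)) :
    dist z' w' ≤ 6 * dist z w ∧ dist z w ≤ 18 * dist z' w' := by
  have hz0 := z.im_pos
  have hw0 := w.im_pos
  have hz'0 := z'.im_pos
  have hw'0 := w'.im_pos
  have s1 := sq_sinh_half_dist z w
  have s2 := sq_sinh_half_dist z' w'
  have hX := Real.sinh_nonneg_iff.2 (by positivity : 0 ≤ dist z w / 2)
  have hX' := Real.sinh_nonneg_iff.2 (by positivity : 0 ≤ dist z' w' / 2)
  have hdiff : z.im - w.im ≤ ‖(z : ℂ) - w‖ := by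
    have h := (le_abs_self _).trans (Complex.abs_im_le_norm ((z : ℂ) - w))
    simpa using h
  set X := Real.sinh (dist z w / 2)
  set X' := Real.sinh (dist z' w' / 2)
  set d := ‖(z : ℂ) - w‖
  set d' := ‖(z' : ℂ) - w'‖
  have hd0 : 0 ≤ d := norm_nonneg _
  have hd'0 : 0 ≤ d' := norm_nonneg _
  rw [eq_div_iff (by positivity)] at s1 s2
  -- the factor `E` is at most `4 (1 + X)`
  have hq : d / w.im ≤ 4 * X ^ 2 + 2 * X := by
    have h3 : (d / w.im) ^ 2 ≤ (2 * X) ^ 2 * (1 + d / w.im) := by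
      have e1 : 1 + d / w.im = (w.im + d) / w.im := by field_simp
      rw [e1, div_pow, mul_div_assoc', div_le_div_iff₀ (by positivity) hw0]
      have : d ^ 2 ≤ (2 * X) ^ 2 * (w.im + d) * w.im := by
        rw [← s1]
        have : z.im * w.im ≤ (w.im + d) * w.im := by gcongr; linarith
        nlinarith [sq_nonneg X]
      nlinarith [mul_le_mul_of_nonneg_right this hw0.le]
    have := le_of_sq_le_one_add_mul (by positivity) h3
    linarith
  have hEX : E ≤ 4 * (1 + X) := by
    apply le_of_sq_le_sq _ (by positivity)
    refine hE'.trans ?_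
    have : (z.im + d) / w.im ≤ 1 + 2 * (d / w.im) := by
      rw [div_le_iff₀ hw0]
      have : (1 + 2 * (d / w.im)) * w.im = w.im + 2 * d := by field_simp
      rw [this]; linarith
    nlinarith
  have hkk : 0 < k₁ * k₂ := mul_pos hk₁ hk₂
  have hyy : 0 < z.im * w.im := mul_pos hz0 hw0
  have u1 : 49 / 64 * ((k₁ * k₂) * (z.im * w.im)) ≤ z'.im * w'.im := by
    have := mul_le_mul hz.1 hw.1 (by positivity) hz'0.le
    linarith
  have u2 : z'.im * w'.im ≤ 81 / 64 * ((k₁ * k₂) * (z.im * w.im)) := by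
    have := mul_le_mul hz.2 hw.2 hw'0.le (by positivity)
    linarith
  have u3 : 49 / 64 * (k ^ 2 * d ^ 2) ≤ d' ^ 2 := by
    have := pow_le_pow_left₀ (by positivity) hd.1 2
    linarith
  have u4 : d' ^ 2 ≤ 81 / 64 * (k ^ 2 * d ^ 2) := by
    have := pow_le_pow_left₀ hd'0 hd.2 2
    linarith
  have hP : 0 < 4 * ((k₁ * k₂) * (z.im * w.im)) := by positivity
  -- In both directions the ratio of X'² to X² is bounded by (81/49) E, and (81/49) · 4 ≤ 9.
  have v1 : X' ^ 2 ≤ 9 * (1 + X) * X ^ 2 := by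
    have h3 : 49 / 64 * X' ^ 2 * (4 * ((k₁ * k₂) * (z.im * w.im))) ≤
        81 / 64 * (E * X ^ 2) * (4 * ((k₁ * k₂) * (z.im * w.im))) := by
      calc _ = X' ^ 2 * (4 * (49 / 64 * ((k₁ * k₂) * (z.im * w.im)))) := by ring
        _ ≤ X' ^ 2 * (4 * (z'.im * w'.im)) := by gcongr
        _ = d' ^ 2 := s2
        _ ≤ 81 / 64 * (k ^ 2 * d ^ 2) := u4
        _ ≤ 81 / 64 * (E * (k₁ * k₂) * d ^ 2) := by gcongr
        _ = _ := by rw [← s1]; ring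
    have h4 := le_of_mul_le_mul_right h3 hP
    have h5 : E * X ^ 2 ≤ 4 * (1 + X) * X ^ 2 := by gcongr
    have h6 : 0 ≤ (1 + X) * X ^ 2 := by positivity
    linarith
  have v2 : X ^ 2 ≤ 9 * (1 + X) * X' ^ 2 := by
    have h3 : 49 / 64 * X ^ 2 * (4 * ((k₁ * k₂) * (z.im * w.im))) ≤
        81 / 64 * (E * X' ^ 2) * (4 * ((k₁ * k₂) * (z.im * w.im))) := by
      calc _ = 49 / 64 * ((k₁ * k₂) * (X ^ 2 * (4 * (z.im * w.im)))) := by ring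
        _ = 49 / 64 * ((k₁ * k₂) * d ^ 2) := by rw [s1]
        _ ≤ 49 / 64 * (E * k ^ 2 * d ^ 2) := by gcongr
        _ = E * (49 / 64 * (k ^ 2 * d ^ 2)) := by ring
        _ ≤ E * d' ^ 2 := by gcongr
        _ = E * X' ^ 2 * (4 * (z'.im * w'.im)) := by rw [← s2]; ring
        _ ≤ E * X' ^ 2 * (4 * (81 / 64 * ((k₁ * k₂) * (z.im * w.im)))) := by gcongr
        _ = _ := by ring
    have h4 := le_of_mul_le_mul_right h3 hP
    have h5 : E * X' ^ 2 ≤ 4 * (1 + X) * X' ^ 2 := by gcongr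
    have h6 : 0 ≤ (1 + X) * X' ^ 2 := by positivity
    linarith
  have w1 := le_mul_of_sq_sinh_le (by positivity) v1
  have w2 := le_mul_of_sq_le_sinh (by positivity) v2
  constructor <;> linarith

lemma dist_kernelExt_bounds (hf : IsSmall (fun x => (f x : ℂ)) e)
    (hh : IsExpPrimitive 1 (fun x => (f x : ℂ)) fun x => (h x : ℂ)) (hK : IsKernel K M)
    (hMe : M * e ≤ 1 / 576) (he : e ≤ 1 / 400) {F : UpperHalfPlane → UpperHalfPlane}
    (hF : ∀ z : UpperHalfPlane, (F z : ℂ) = kernelExt K (fun x => (h x : ℂ)) z)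
    (z w : UpperHalfPlane) :
    dist (F z) (F w) ≤ 6 * dist z w ∧ dist z w ≤ 18 * dist (F z) (F w) := by
  wlog hwz : w.im ≤ z.im generalizing z w
  · rw [dist_comm (F z), dist_comm z]
    exact this w z (le_of_not_ge hwz)
  have him : ∀ z : UpperHalfPlane, (kernelExt K (fun x => (h x : ℂ)) z).im = (F z).im := fun z => by
    rw [← hF]; rfl
  have hz0 : 0 < (z : ℂ).im := z.im_pos
  have hw0 : 0 < (w : ℂ).im := w.im_pos
  have b1 := im_kernelExt_bounds hf hh hK hMe hz0
  have b2 := im_kernelExt_bounds hf hh hK hMe hw0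
  have b3 := norm_kernelExt_sub_bounds hf hh hK hMe hz0 hw0.le hwz
  have b4 := exp_logSlope_sub_le hf he hz0 hw0 hwz
  rw [him] at b1 b2
  rw [← hF, ← hF] at b3
  refine dist_le_of_comparable (Real.exp_pos _) (Real.exp_pos _) (Real.exp_pos _) b1 b2 b3
    (Real.exp_pos _) ?_ ?_ b4
  · rw [← Real.exp_nat_mul, ← Real.exp_add, ← Real.exp_add]
    apply Real.exp_le_exp.2
    have := le_abs_self (2 * logSlope f (z : ℂ).re ((z : ℂ).im + 2 * ‖(z : ℂ) - w‖) -
      logSlope f (z : ℂ).re (3 * (z : ℂ).im) - logSlope f (w : ℂ).re (3 * (w : ℂ).im))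
    push_cast
    linarith
  · rw [← Real.exp_nat_mul, ← Real.exp_add, ← Real.exp_add]
    apply Real.exp_le_exp.2
    have := neg_abs_le (2 * logSlope f (z : ℂ).re ((z : ℂ).im + 2 * ‖(z : ℂ) - w‖) -
      logSlope f (z : ℂ).re (3 * (z : ℂ).im) - logSlope f (w : ℂ).re (3 * (w : ℂ).im))
    push_cast
    linarith

/-! ### The extension of h to the half plane: surjectivity and boundary values -/

lemma exists_lift_kernelExt (hf : IsSmall (fun x => (f x : ℂ)) e)
    (hh : IsExpPrimitive 1 (fun x => (f x : ℂ)) fun x => (h x : ℂ)) (hK : IsKernel K M)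
    (hMe : M * e ≤ 1 / 576) : ∃ F : UpperHalfPlane → UpperHalfPlane,
      ∀ z : UpperHalfPlane, (F z : ℂ) = kernelExt K (fun x => (h x : ℂ)) z := by
  refine ⟨fun z => ⟨kernelExt K (fun x => (h x : ℂ)) z, ?_⟩, fun z => rfl⟩
  have hz0 : 0 < (z : ℂ).im := z.im_pos
  refine lt_of_lt_of_le ?_ (im_kernelExt_bounds hf hh hK hMe hz0).1
  have := Real.exp_pos (logSlope f (z : ℂ).re (3 * (z : ℂ).im))
  positivity

lemma kernelExt_extension (hf : IsSmall (fun x => (f x : ℂ)) e)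
    (hh : IsExpPrimitive 1 (fun x => (f x : ℂ)) fun x => (h x : ℂ)) (hK : IsKernel K M)
    (hMe : M * e ≤ 1 / 576) (he : e ≤ 1 / 400) :
    IsQCExtension (kernelExt K fun x => (h x : ℂ)) h ∧
      IsQuasiIsometric (kernelExt K fun x => (h x : ℂ)) ∧
      beltrami (kernelExt K fun x => (h x : ℂ)) ∈ classM := by
  obtain ⟨F, hF⟩ := exists_lift_kernelExt hf hh hK hMe
  have hd := dist_kernelExt_bounds hf hh hK hMe he hF
  have hlip : LipschitzWith 18 F := LipschitzWith.of_dist_le_mul fun z w => by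
    refine (hd z w).1.trans ?_
    push_cast
    gcongr
    norm_num
  have hanti : AntilipschitzWith 18 F := AntilipschitzWith.of_le_mul_dist fun z w => by
    simpa using (hd z w).2
  have hqc := hf.isQuasiconformalOn hh one_ne_zero hK hMe
  have himage : kernelExt K (fun x => (h x : ℂ)) '' U =
      (fun z : UpperHalfPlane => (z : ℂ)) '' range F := by
    ext w
    constructor
    · rintro ⟨z, hz, rfl⟩
      exact ⟨_, ⟨⟨z, hz⟩, rfl⟩, hF ⟨z, hz⟩⟩
    · rintro ⟨_, ⟨z, rfl⟩, rfl⟩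
      exact ⟨z, z.im_pos, (hF z).symm⟩
  -- The range is closed because an anti-Lipschitz uniformly continuous map of a complete space has
  -- closed range, and open because quasiconformal maps are open embeddings; the half plane is
  -- connected.
  have hrange : range F = univ := by
    refine IsClopen.eq_univ ⟨hanti.isClosed_range hlip.uniformContinuous, ?_⟩ (range_nonempty F)
    have ho : IsOpen (kernelExt K (fun x => (h x : ℂ)) '' U) := by
      have := hqc.homeo.isOpen_range
      rwa [range_domRestrict] at this
    rw [himage] at ho
    have := ho.preimage UpperHalfPlane.continuous_coe
    rwa [preimage_image_eq _ UpperHalfPlane.coe_injective] at this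
  refine ⟨⟨hqc, ?_, fun x => ?_⟩, ⟨F, hF, 18, hlip, hanti⟩,
    hf.beltrami_mem_classM hh one_ne_zero hK hMe⟩
  · rw [himage, hrange, image_univ]
    ext z
    constructor
    · rintro ⟨w, rfl⟩
      exact w.im_pos
    · intro hz
      exact ⟨⟨z, hz⟩, rfl⟩
  · have := (continuous_kernelExt hK (hf.continuous hh)).tendsto (x : ℂ)
    rw [hK.kernelExt_ofReal] at this
    exact this.mono_left nhdsWithin_le_nhds

/-- The fundamental theorem of calculus for absolutely continuous functions, with e^(log h') = h'
almost everywhere. -/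
lemma isExpPrimitive_log_deriv (hac : ∀ a b : ℝ, AbsolutelyContinuousOnInterval h a b)
    (hpos : ∀ᵐ x : ℝ, 0 < deriv h x) :
    IsExpPrimitive 1 (fun x => ((Real.log (deriv h x) : ℝ) : ℂ)) fun x => (h x : ℂ) := by
  intro s t
  have h1 : ∫ x in s..t, Complex.exp ((Real.log (deriv h x) : ℝ) : ℂ) =
      ∫ x in s..t, ((deriv h x : ℝ) : ℂ) := by
    refine intervalIntegral.integral_congr_ae ?_
    filter_upwards [hpos] with x hx _
    rw [← Complex.ofReal_exp, Real.exp_log hx]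
  rw [h1, one_mul, intervalIntegral.integral_ofReal, (hac s t).integral_deriv_eq_sub,
    Complex.ofReal_sub]

lemma memHalf_ofReal {f : ℝ → ℝ} (hf : MemHalf f) :
    MemHalf (fun x => (f x : ℂ)) ∧ halfNorm (fun x => (f x : ℂ)) = halfNorm f := by
  have h : halfNorm (fun x => (f x : ℂ)) = halfNorm f := by
    simp only [halfNorm, ← Complex.ofReal_sub, Complex.norm_real]
  refine ⟨⟨fun x => ?_, h ▸ hf.2⟩, h⟩
  obtain ⟨s, hs, hfs⟩ := hf.1 x
  exact ⟨s, hs, hfs.ofReal⟩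

end WeilPetersson

end

theorem lemma5p1 (φ ψ : ℝ → ℝ) (hφψ : WeilPetersson.IsSemmesPair φ ψ) :
    ∃ δ : ℝ, 0 < δ ∧
      (∃ C : NNReal, ∀ u : ℝ → ℂ, WeilPetersson.MemHalf u →
        WeilPetersson.halfNorm u < ENNReal.ofReal δ →
          LocallyIntegrable (fun t => Complex.exp (u t)) volume ∧
          (∫ t in (0 : ℝ)..1, Complex.exp (u t)) ≠ 0 ∧
          WeilPetersson.IsQuasiconformalOn (WeilPetersson.rhoMap φ ψ u) WeilPetersson.U ∧
          WeilPetersson.wpNorm (WeilPetersson.beltrami (WeilPetersson.rhoMap φ ψ u)) ≤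
            C * WeilPetersson.halfNorm u ∧
          WeilPetersson.beltrami (WeilPetersson.rhoMap φ ψ u) ∈ WeilPetersson.classM) ∧
      (∀ h : ℝ → ℝ, WeilPetersson.IsIncreasingHomeo h →
        (∀ a b : ℝ, AbsolutelyContinuousOnInterval h a b) →
        (∀ᵐ x : ℝ, 0 < deriv h x) →
        WeilPetersson.MemHalf (fun x => Real.log (deriv h x)) →
        WeilPetersson.halfNorm (fun x => Real.log (deriv h x)) < ENNReal.ofReal δ →
          (∃ w : ℂ → ℂ, WeilPetersson.IsQCExtension w h ∧
            WeilPetersson.IsQuasiIsometric w ∧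
            WeilPetersson.beltrami w ∈ WeilPetersson.classM) ∧
          h ∈ WeilPetersson.classWP) := by
  obtain ⟨M, hM, hK⟩ := hφψ.exists_isKernel
  have hπ := Real.pi_pos
  -- Using M + 1 makes both 2πδ and 2πδM at most 1/600, which is below each threshold 1/40, 1/400
  -- and 1/576.
  set δ : ℝ := 1 / 600 / (2 * Real.pi * (M + 1)) with hδ
  have hδ0 : 0 < δ := by positivity
  have e1 : (M + 1) * (2 * Real.pi * δ) = 1 / 600 := by rw [hδ]; field_simp
  have hδ1 : 2 * Real.pi * δ ≤ 1 / 600 := by nlinarith [mul_pos hM (mul_pos hπ hδ0)]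
  have hδ2 : M * (2 * Real.pi * δ) ≤ 1 / 600 := by nlinarith [mul_pos hπ hδ0]
  refine ⟨δ, hδ0, ⟨_, fun u hu hu' => WeilPetersson.rhoMap_properties hφψ hK
    (by linarith) (by linarith) hu hu'⟩, fun h hh hac hpos hmem hsmall => ?_⟩
  obtain ⟨hmem', heq⟩ := WeilPetersson.memHalf_ofReal hmem
  rw [← heq] at hsmall
  have hs := WeilPetersson.isSmall_of_ae_eq hmem' hsmall (by linarith)
    (by have := measurable_deriv h; fun_prop) (ae_eq_refl _)
  have hle : 2 * Real.pi *
      (WeilPetersson.halfNorm fun x => ((Real.log (deriv h x) : ℝ) : ℂ)).toReal ≤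
      2 * Real.pi * δ := by
    gcongr
    exact (ENNReal.toReal_lt_of_lt_ofReal hsmall).le
  obtain ⟨h1, h2, h3⟩ := WeilPetersson.kernelExt_extension hs
    (WeilPetersson.isExpPrimitive_log_deriv hac hpos) hK
    ((mul_le_mul_of_nonneg_left hle hM.le).trans (by linarith)) (by linarith)
  exact ⟨⟨_, h1, h2, h3⟩, hh, _, h1, h3⟩
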